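/- Let $\Gamma$ be a Polish space and let $K\subseteq\mathbb R^\Gamma$ be a set of real-valued functions on $\Gamma$ which, in the topology of pointwise convergence on $\Gamma$, is compact and separable. Assume that each function $s\in K$ has only countably many points of discontinuity in $\Gamma$. Then the space $\mathcal C(K)$ of continuous real-valued functions on $K$ admits a norm $\nu$ such that 1. $\nu$ is equivalent to the supremum norm: there are constants $a,b>0$ with $a\|x\|_\infty\le\nu(x)\le b\|x\|_\infty$ for all $x\in\mathcal C(K)$; 2. $\nu$ is lower semicontinuous on $\mathcal C(K)$ for the topology $\mathfrak T_p$ of pointwise convergence on $K$; 3. $\nu$ is locally uniformly rotund (LUR): whenever $x\in\mathcal C(K)$ and $(x_n)$ is a sequence in $\mathcal C(K)$ such that $\nu(x_n)\to\nu(x)$ and $\nu(\tfrac12(x+x_n))\to\nu(x)$, one has $\nu(x-x_n)\to 0$. -/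

import Mathlib

open Filter Topology

/-- The topology of pointwise convergence on `C(X, ℝ)`: the coarsest topology for which all the
evaluations at points of `X` are continuous. -/
abbrev pointwiseTopology (X : Type*) [TopologicalSpace X] : TopologicalSpace C(X, ℝ) :=
  TopologicalSpace.induced (fun f : C(X, ℝ) => (f : X → ℝ)) Pi.topologicalSpace

/-- The function `ν` on `C(X, ℝ)` is lower semicontinuous for the topology of pointwise
convergence. -/
def IsPointwiseLSC {X : Type*} [TopologicalSpace X] (ν : C(X, ℝ) → ℝ) : Prop :=
  letI : TopologicalSpace C(X, ℝ) := pointwiseTopology X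
  LowerSemicontinuous ν

/-- The seminorm `ν` is a norm equivalent to the given norm of `E`. (The lower bound makes `ν`
definite.) -/
def IsEquivalentNorm {E : Type*} [NormedAddCommGroup E] [NormedSpace ℝ E]
    (ν : Seminorm ℝ E) : Prop :=
  ∃ a b : ℝ, 0 < a ∧ 0 < b ∧ ∀ x : E, a * ‖x‖ ≤ ν x ∧ ν x ≤ b * ‖x‖

/-- The (semi)norm `ν` is locally uniformly rotund: whenever `ν (x n)` and `ν ((x₀ + x n) / 2)`
both tend to `ν x₀`, one has `ν (x₀ - x n) → 0`. -/
def IsLUR {E : Type*} [AddCommGroup E] [Module ℝ E] (ν : Seminorm ℝ E) : Prop :=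
  ∀ (x₀ : E) (x : ℕ → E),
    Tendsto (fun n => ν (x n)) atTop (𝓝 (ν x₀)) →
    Tendsto (fun n => ν ((1 / 2 : ℝ) • (x₀ + x n))) atTop (𝓝 (ν x₀)) →
    Tendsto (fun n => ν (x₀ - x n)) atTop (𝓝 0)

/-! ### Equivalent norms as gauges of sublevel sets of convex functions. -/

section LURNorm

variable {E : Type*} [NormedAddCommGroup E] [NormedSpace ℝ E]

/-! The engine is a slicing criterion, `exists_LUR_seminorm_of_sliceCover`: it suffices that for
each ε the space C(K) is a countable union of pieces, each point of which lies in a slice of its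
piece of diameter at most ε, cut off by a pointwise continuous functional. Suprema of affine
functions attached to these slices form a countable family of convex lower semicontinuous functions,
and the gauge of a sublevel set of a weighted sum of their squares is the norm. By
`SliceCover.comp`, slicings can be carried out in successive rounds, with any countable amount of
information fixed for free.

Each x in C(K) is controlled up to ε by a finite tuple M x of points of Γ, but these points range
over an uncountable set and have to be found by slicing. After a refinement of the topology of Γ
(`exists_polishSpace_continuous`) a dense sequence of K consists of continuous functions. Fix a
countable dense Q in Γ. If s, t in K agree on Q, then s ≠ t only at discontinuities of s or t, so {δ
< |s - t|} is countable; `exists_cbDeriv_eq_empty` bounds the Cantor–Bendixson ranks of all these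
sets by a single countable ordinal, since otherwise a Cantor scheme yields a pair in K with
uncountably many discontinuities.

The ranks drive `exists_sliceCover_label`. If x separates by more than ε some s, t that agree on Q
and on the coordinates already found, take such a pair with minimal vector of ranks along M x. The
functional "evaluation at s minus evaluation at t" cuts off functions y for which the pair is still
of this kind; minimality for y, and the fact that the rank has a strict local maximum at each point
where |s - t| > δ, force M y and M x to coincide at those coordinates. Each round finds a new
coordinate, so the rounds stop. Then `sliceCover_norm_of_label` needs only rounded values on a
finite net to make slices small. -/

/-- Lower semicontinuity with respect to an assignment `N` of neighbourhood filters. -/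
def LSCAlong (N : E → Filter E) (f : E → ℝ) : Prop :=
  ∀ y, ∀ c < f y, ∀ᶠ z in N y, c < f z

/-- An even convex function that dominates `‖·‖ ^ 2`, is small at `0` and is Lipschitz on bounded
sets has a sublevel set `{Φ ≤ 1}` that is the unit ball of an equivalent norm. -/
theorem exists_seminorm_of_convex_even (N : E → Filter E)
    (hN : ∀ (c : ℝ) (y : E), Tendsto (fun z : E => c • z) (N y) (N (c • y))) (Φ : E → ℝ)
    (hconv : ConvexOn ℝ Set.univ Φ) (heven : ∀ y, Φ (-y) = Φ y) (hnorm : ∀ y, ‖y‖ ^ 2 ≤ Φ y)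
    (hlip : ∀ a b, |Φ a - Φ b| ≤ 4 * (2 + ‖a‖ + ‖b‖) * ‖a - b‖) (h0 : Φ 0 ≤ 1 / 4)
    (hlsc : LSCAlong N Φ) :
    ∃ ν : Seminorm ℝ E, IsEquivalentNorm ν ∧ LSCAlong N ν ∧
      ∀ y, ν y ≤ 1 ↔ Φ y ≤ 1 := by
  have hcont : Continuous Φ := by
    rw [continuous_iff_continuousAt]
    intro x
    rw [ContinuousAt, tendsto_iff_norm_sub_tendsto_zero]
    have h1 : Tendsto (fun y : E => 4 * (2 + ‖y‖ + ‖x‖) * ‖y - x‖) (𝓝 x) (𝓝 0) := by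
      have : Continuous fun y : E => 4 * (2 + ‖y‖ + ‖x‖) * ‖y - x‖ := by fun_prop
      simpa using this.tendsto x
    exact squeeze_zero (fun _ => norm_nonneg _) (fun y => hlip y x) h1
  set s : Set E := {y | Φ y ≤ 1} with hs
  have hsc : Convex ℝ s := by
    have := hconv.convex_le 1
    simpa [hs] using this
  have hsclosed : IsClosed s := isClosed_le hcont continuous_const
  -- The radius works because 1/4 + 4 · (2 + 1/16) / 16 < 1.
  have hbs : Metric.ball (0 : E) (1 / 16) ⊆ s := by
    intro y hy
    have hy' : ‖y‖ < 1 / 16 := by simpa using hy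
    have := hlip y 0
    simp only [norm_zero, sub_zero, add_zero] at this
    have h2 := le_of_abs_le this
    have h3 := norm_nonneg y
    change Φ y ≤ 1
    nlinarith
  have hsb : s ⊆ Metric.closedBall (0 : E) 1 := by
    intro y hy
    have h1 : Φ y ≤ 1 := hy
    have := hnorm y
    have h3 := norm_nonneg y
    rw [mem_closedBall_zero_iff]
    nlinarith
  have hnhds : s ∈ 𝓝 (0 : E) := mem_of_superset (Metric.ball_mem_nhds _ (by norm_num)) hbs
  have hbal : Balanced ℝ s := (balanced_iff_neg_mem hsc).2 fun y hy => by
    change Φ (-y) ≤ 1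
    rw [heven]
    exact hy
  have habs : Absorbent ℝ s := absorbent_nhds_zero hnhds
  have hle : ∀ y, gaugeSeminorm hbal hsc habs y ≤ 1 ↔ Φ y ≤ 1 := by
    intro y
    rw [gaugeSeminorm_toFun, gauge_le_one_iff_mem_closure hsc hnhds, hsclosed.closure_eq]
    rfl
  refine ⟨gaugeSeminorm hbal hsc habs, ⟨1, 16, by norm_num, by norm_num, fun y => ⟨?_, ?_⟩⟩, ?_,
    hle⟩
  · rw [gaugeSeminorm_toFun]
    have := le_gauge_of_subset_closedBall (x := y) habs zero_le_one hsb
    simpa using this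
  · rw [gaugeSeminorm_toFun]
    have := gauge_mono (absorbent_nhds_zero (Metric.ball_mem_nhds (0 : E)
      (show (0 : ℝ) < 1 / 16 by norm_num))) hbs y
    rw [gauge_ball (by norm_num)] at this
    linarith
  · intro y c hc
    set ν := gaugeSeminorm hbal hsc habs
    rcases lt_or_ge c 0 with hc0 | hc0
    · exact Eventually.of_forall fun z => hc0.trans_le (apply_nonneg ν z)
    obtain ⟨r, hcr, hr⟩ := exists_between hc
    have hr0 : 0 < r := hc0.trans_lt hcr
    have key : ∀ z, r < ν z ↔ 1 < Φ (r⁻¹ • z) := by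
      intro z
      rw [← not_le, ← not_le, not_iff_not, ← hle, map_smul_eq_mul, norm_inv, Real.norm_eq_abs,
        abs_of_pos hr0, inv_mul_le_iff₀ hr0, mul_one]
    have h1 := hlsc (r⁻¹ • y) 1 ((key y).1 hr)
    filter_upwards [(hN r⁻¹ y).eventually h1] with z hz
    exact hcr.trans ((key z).2 hz)

/-- If `Φ` and `ν` share the unit ball, then `Φ (w n) → 1` as soon as `ν (w n) → 1`. -/
theorem tendsto_one_of_seminorm_tendsto_one {ν : Seminorm ℝ E} (hν : IsEquivalentNorm ν)
    {Φ : E → ℝ} (hlip : ∀ a b, |Φ a - Φ b| ≤ 4 * (2 + ‖a‖ + ‖b‖) * ‖a - b‖)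
    (hle : ∀ y, ν y ≤ 1 ↔ Φ y ≤ 1) {w : ℕ → E} (hw : Tendsto (fun n => ν (w n)) atTop (𝓝 1)) :
    Tendsto (fun n => Φ (w n)) atTop (𝓝 1) := by
  have hone : ∀ y, ν y = 1 → Φ y = 1 := by
    intro y hy
    refine le_antisymm ((hle y).1 hy.le) ?_
    -- The points approaching `y` from outside lie off the unit ball of `ν`, hence satisfy `Φ > 1`;
    -- continuity gives `Φ y ≥ 1`.
    have h1 : Tendsto (fun n : ℕ => Φ ((1 + 1 / ((n : ℝ) + 1)) • y)) atTop (𝓝 (Φ y)) := by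
      rw [tendsto_iff_norm_sub_tendsto_zero]
      have h0 : Tendsto (fun n : ℕ => (1 + 1 / ((n : ℝ) + 1)) • y) atTop (𝓝 y) := by
        have := (tendsto_one_div_add_atTop_nhds_zero_nat (𝕜 := ℝ)).const_add 1
        simpa using this.smul_const y
      have h2 : Tendsto (fun n : ℕ => 4 * (2 + ‖(1 + 1 / ((n : ℝ) + 1)) • y‖ + ‖y‖) *
          ‖(1 + 1 / ((n : ℝ) + 1)) • y - y‖) atTop (𝓝 0) := by
        have := ((h0.norm.const_add 2).add_const ‖y‖).const_mul 4 |>.mul (h0.sub_const y).norm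
        simpa using this
      exact squeeze_zero (fun _ => norm_nonneg _) (fun n => hlip _ _) h2
    refine ge_of_tendsto' h1 fun n => ?_
    by_contra hlt
    have := (hle _).2 (not_le.1 hlt).le
    rw [map_smul_eq_mul, hy, mul_one, Real.norm_eq_abs, abs_of_pos (by positivity)] at this
    have : (0 : ℝ) < 1 / ((n : ℝ) + 1) := by positivity
    linarith
  obtain ⟨a, b, ha, hb, hab⟩ := hν
  have hpos : ∀ᶠ n in atTop, 1 / 2 < ν (w n) := hw.eventually (lt_mem_nhds (by norm_num))
  have hlt : ∀ᶠ n in atTop, ν (w n) < 2 := hw.eventually (gt_mem_nhds (by norm_num))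
  rw [tendsto_iff_norm_sub_tendsto_zero]
  have h2 : Tendsto (fun n => 4 * (2 + 2 / a + 1 / a) * (|1 - (ν (w n))⁻¹| * (2 / a))) atTop
      (𝓝 0) := by
    have := ((hw.inv₀ one_ne_zero).const_sub 1).abs.mul_const (2 / a)
    simpa using this.const_mul (4 * (2 + 2 / a + 1 / a))
  refine squeeze_zero' (Eventually.of_forall fun _ => norm_nonneg _) ?_ h2
  filter_upwards [hpos, hlt] with n hn hn'
  have hn0 : 0 < ν (w n) := by linarith
  have h1 : ν ((ν (w n))⁻¹ • w n) = 1 := by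
    rw [map_smul_eq_mul, norm_inv, Real.norm_eq_abs, abs_of_pos hn0, inv_mul_cancel₀ hn0.ne']
  have h3 := hlip (w n) ((ν (w n))⁻¹ • w n)
  rw [hone _ h1] at h3
  have h4 : ‖w n‖ ≤ 2 / a := by
    rw [le_div_iff₀ ha]
    have := (hab (w n)).1
    linarith
  have h5 : ‖(ν (w n))⁻¹ • w n‖ ≤ 1 / a := by
    rw [le_div_iff₀ ha]
    have := (hab ((ν (w n))⁻¹ • w n)).1
    linarith
  have h6 : ‖w n - (ν (w n))⁻¹ • w n‖ = |1 - (ν (w n))⁻¹| * ‖w n‖ := by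
    rw [← Real.norm_eq_abs, ← norm_smul, sub_smul, one_smul]
  rw [h6] at h3
  rw [Real.norm_eq_abs]
  refine h3.trans ?_
  have : 0 ≤ 2 / a := by positivity
  gcongr

/-- The renorming principle behind the LUR norms: rotundity can be tested on a countable family of
convex Lipschitz functions. -/
theorem exists_LUR_seminorm_of_convex_even (N : E → Filter E)
    (hN : ∀ (c : ℝ) (y : E), Tendsto (fun z : E => c • z) (N y) (N (c • y))) (Φ : E → ℝ)
    (hconv : ConvexOn ℝ Set.univ Φ) (heven : ∀ y, Φ (-y) = Φ y) (hnorm : ∀ y, ‖y‖ ^ 2 ≤ Φ y)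
    (hlip : ∀ a b, |Φ a - Φ b| ≤ 4 * (2 + ‖a‖ + ‖b‖) * ‖a - b‖) (h0 : Φ 0 ≤ 1 / 4)
    (hlsc : LSCAlong N Φ)
    (hrot : ∀ (x : E) (y : ℕ → E),
      Tendsto (fun n => (Φ x + Φ (y n)) / 2 - Φ ((1 / 2 : ℝ) • (x + y n))) atTop (𝓝 0) →
      Tendsto y atTop (𝓝 x)) :
    ∃ ν : Seminorm ℝ E, IsEquivalentNorm ν ∧ LSCAlong N ν ∧ IsLUR ν := by
  obtain ⟨ν, hν, hνlsc, hle⟩ := exists_seminorm_of_convex_even N hN Φ hconv heven hnorm hlip h0 hlsc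
  refine ⟨ν, hν, hνlsc, fun x₀ x hx hmid => ?_⟩
  obtain ⟨a, b, ha, hb, hab⟩ := id hν
  suffices h : Tendsto x atTop (𝓝 x₀) by
    have h1 : Tendsto (fun n => b * ‖x₀ - x n‖) atTop (𝓝 0) := by
      simpa using ((h.const_sub x₀).norm).const_mul b
    exact squeeze_zero (fun _ => apply_nonneg ν _) (fun n => (hab _).2) h1
  rcases (apply_nonneg ν x₀).eq_or_lt with h | hpos
  · rw [← h] at hx
    have hx₀ : x₀ = 0 := by
      have := (hab x₀).1
      rw [← h] at this
      have h3 := norm_nonneg x₀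
      exact norm_eq_zero.1 (by nlinarith)
    rw [hx₀, tendsto_zero_iff_norm_tendsto_zero]
    have h1 : Tendsto (fun n => a⁻¹ * ν (x n)) atTop (𝓝 0) := by simpa using hx.const_mul a⁻¹
    refine squeeze_zero (fun _ => norm_nonneg _) (fun n => ?_) h1
    rw [le_inv_mul_iff₀ ha]
    exact (hab _).1
  · set r := ν x₀ with hr
    have hscale : ∀ y, ν (r⁻¹ • y) = r⁻¹ * ν y := fun y => by
      rw [map_smul_eq_mul, norm_inv, Real.norm_eq_abs, abs_of_pos hpos]
    have hu : ν (r⁻¹ • x₀) = 1 := by rw [hscale, ← hr, inv_mul_cancel₀ hpos.ne']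
    have hz : Tendsto (fun n => ν (r⁻¹ • x n)) atTop (𝓝 1) := by
      simp only [hscale]
      simpa [inv_mul_cancel₀ hpos.ne'] using hx.const_mul r⁻¹
    have hm : Tendsto (fun n => ν ((1 / 2 : ℝ) • (r⁻¹ • x₀ + r⁻¹ • x n))) atTop (𝓝 1) := by
      have : ∀ n, (1 / 2 : ℝ) • (r⁻¹ • x₀ + r⁻¹ • x n) = r⁻¹ • ((1 / 2 : ℝ) • (x₀ + x n)) :=
        fun n => by rw [← smul_add, smul_comm]
      simp only [this, hscale]
      simpa [inv_mul_cancel₀ hpos.ne'] using hmid.const_mul r⁻¹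
    have hΦu : Tendsto (fun _ : ℕ => Φ (r⁻¹ • x₀)) atTop (𝓝 1) :=
      tendsto_one_of_seminorm_tendsto_one hν hlip hle (by simp [hu])
    have hΦz := tendsto_one_of_seminorm_tendsto_one hν hlip hle hz
    have hΦm := tendsto_one_of_seminorm_tendsto_one hν hlip hle hm
    have h1 := hrot (r⁻¹ • x₀) (fun n => r⁻¹ • x n) (by
      simpa using ((hΦu.add hΦz).div_const 2).sub hΦm)
    simpa [smul_smul, mul_inv_cancel₀ hpos.ne'] using h1.const_smul r

end LURNorm

/-! ### Stability of lower semicontinuity along a filter assignment. -/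

section LSC

variable {E : Type*}

theorem LSCAlong.add {N : E → Filter E} {f g : E → ℝ} (hf : LSCAlong N f) (hg : LSCAlong N g) :
    LSCAlong N fun y => f y + g y := by
  intro y c hc
  filter_upwards [hf y (f y - (f y + g y - c) / 2) (by linarith),
    hg y (g y - (f y + g y - c) / 2) (by linarith)] with z h1 h2
  linarith

theorem LSCAlong.const_mul {N : E → Filter E} {f : E → ℝ} (hf : LSCAlong N f) {a : ℝ}
    (ha : 0 < a) : LSCAlong N fun y => a * f y := by
  intro y c hc
  filter_upwards [hf y (c / a) (by rwa [div_lt_iff₀' ha])] with z hz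
  rwa [div_lt_iff₀' ha] at hz

theorem LSCAlong.sq {N : E → Filter E} {f : E → ℝ} (hf : LSCAlong N f) (h0 : ∀ y, 0 ≤ f y) :
    LSCAlong N fun y => f y ^ 2 := by
  intro y c hc
  rcases lt_or_ge c 0 with h | h
  · exact Eventually.of_forall fun z => h.trans_le (sq_nonneg _)
  filter_upwards [hf y (Real.sqrt c) ((Real.sqrt_lt' (lt_of_le_of_ne (h0 y) fun h' => by
    simp only [← h', ne_eq, OfNat.ofNat_ne_zero, not_false_eq_true, zero_pow] at hc
    exact absurd hc h.not_gt)).2 hc)] with z hz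
  exact (Real.sqrt_lt' ((Real.sqrt_nonneg c).trans_lt hz)).1 hz

theorem LSCAlong.tsum {N : E → Filter E} {g : ℕ → E → ℝ} (hg : ∀ k, LSCAlong N (g k))
    (h0 : ∀ k y, 0 ≤ g k y) (hs : ∀ y, Summable fun k => g k y) :
    LSCAlong N fun y => ∑' k, g k y := by
  intro y c hc
  obtain ⟨s, hs'⟩ := ((hs y).hasSum.eventually (lt_mem_nhds hc)).exists
  have hfin : ∀ s : Finset ℕ, ∀ c < ∑ k ∈ s, g k y, ∀ᶠ z in N y, c < ∑ k ∈ s, g k z := by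
    intro s
    induction s using Finset.induction_on with
    | empty => intro c hc; exact Eventually.of_forall fun z => by simpa using hc
    | insert a s ha ih =>
      intro c hc
      rw [Finset.sum_insert ha] at hc
      filter_upwards [ih (∑ k ∈ s, g k y - (g a y + ∑ k ∈ s, g k y - c) / 2) (by linarith),
        hg a y (g a y - (g a y + ∑ k ∈ s, g k y - c) / 2) (by linarith)] with z h1 h2
      rw [Finset.sum_insert ha]
      linarith
  filter_upwards [hfin s c hs'] with z hz
  exact hz.trans_le ((hs z).sum_le_tsum s fun k _ => h0 k z)

end LSC

/-! ### LUR norms from countable families of convex functions. -/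

section LURFamily

variable {E : Type*} [NormedAddCommGroup E] [NormedSpace ℝ E]

theorem LSCAlong.comp_neg {N : E → Filter E}
    (hN : ∀ (c : ℝ) (y : E), Tendsto (fun z : E => c • z) (N y) (N (c • y))) {f : E → ℝ}
    (hf : LSCAlong N f) : LSCAlong N fun y => f (-y) := by
  intro y c hc
  have h := hN (-1) y
  simp only [neg_smul, one_smul] at h
  exact h.eventually (hf (-y) c hc)

/-- The square of `q k`, made even and weighted by `2 ^ (-k - 4)`. -/
noncomputable def evenSq (q : ℕ → E → ℝ) (k : ℕ) (y : E) : ℝ :=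
  (1 / 2 : ℝ) ^ (k + 1) / 8 * (q k y ^ 2 + q k (-y) ^ 2)

/-- Convexity bounds the midpoint value by the mean of `q x` and `q y`, and (a² + b²)/2 - ((a +
b)/2)² = ((a - b)/2)². Squaring thus turns a vanishing midpoint gap into convergence of the values.
-/
theorem midpoint_gap_nonneg {q : E → ℝ} (hq0 : ∀ y, 0 ≤ q y) (hqc : ConvexOn ℝ Set.univ q)
    (x y : E) :
    ((q x - q y) / 2) ^ 2 ≤ (q x ^ 2 + q y ^ 2) / 2 - q ((1 / 2 : ℝ) • (x + y)) ^ 2 := by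
  have h := hqc.2 (Set.mem_univ x) (Set.mem_univ y) (show (0 : ℝ) ≤ 1 / 2 by norm_num)
    (show (0 : ℝ) ≤ 1 / 2 by norm_num) (by norm_num)
  rw [← smul_add] at h
  simp only [smul_eq_mul] at h
  have h0 := hq0 ((1 / 2 : ℝ) • (x + y))
  nlinarith

/-- A countable family of convex Lipschitz functions that detects norm convergence (in the rotund
sense) yields an equivalent LUR norm; normalised version. -/
theorem exists_LUR_seminorm_of_normalized_family (N : E → Filter E)
    (hN : ∀ (c : ℝ) (y : E), Tendsto (fun z : E => c • z) (N y) (N (c • y)))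
    (hnorm : LSCAlong N fun y => ‖y‖) (q : ℕ → E → ℝ) (hq0 : ∀ k y, 0 ≤ q k y)
    (hqc : ∀ k, ConvexOn ℝ Set.univ (q k)) (hql : ∀ k a b, q k a ≤ q k b + ‖a - b‖)
    (hq1 : ∀ k, q k 0 ≤ 1) (hqlsc : ∀ k, LSCAlong N (q k))
    (hrot : ∀ (x : E) (y : ℕ → E), (∀ k, Tendsto (fun n => q k (y n)) atTop (𝓝 (q k x))) →
      (∀ k, Tendsto (fun n => q k ((1 / 2 : ℝ) • (x + y n))) atTop (𝓝 (q k x))) →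
      Tendsto y atTop (𝓝 x)) :
    ∃ ν : Seminorm ℝ E, IsEquivalentNorm ν ∧ LSCAlong N ν ∧ IsLUR ν := by
  have hqle : ∀ k y, q k y ≤ 1 + ‖y‖ := fun k y => by
    have := hql k y 0
    rw [sub_zero] at this
    linarith [hq1 k]
  have hw : ∀ k : ℕ, (0 : ℝ) < (1 / 2 : ℝ) ^ (k + 1) / 8 := fun k => by positivity
  have hwsum : HasSum (fun k : ℕ => (1 / 2 : ℝ) ^ (k + 1)) 1 := by
    have := (hasSum_geometric_of_lt_one (r := (1 / 2 : ℝ)) (by norm_num) (by norm_num)).mul_left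
      (1 / 2)
    rw [show (1 / 2 : ℝ) * (1 - 1 / 2)⁻¹ = 1 by norm_num] at this
    simpa only [pow_succ'] using this
  have hG0 : ∀ k y, 0 ≤ evenSq q k y := fun k y => by
    have := hw k
    unfold evenSq
    positivity
  have hGle : ∀ k y, evenSq q k y ≤ (1 / 2 : ℝ) ^ (k + 1) * ((1 + ‖y‖) ^ 2 / 4) := by
    intro k y
    have h1 : q k y ^ 2 ≤ (1 + ‖y‖) ^ 2 := pow_le_pow_left₀ (hq0 _ _) (hqle _ _) 2
    have h2 : q k (-y) ^ 2 ≤ (1 + ‖y‖) ^ 2 :=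
      pow_le_pow_left₀ (hq0 _ _) (by simpa using hqle k (-y)) 2
    have := hw k
    unfold evenSq
    calc _ ≤ (1 / 2 : ℝ) ^ (k + 1) / 8 * ((1 + ‖y‖) ^ 2 + (1 + ‖y‖) ^ 2) := by gcongr
      _ = _ := by ring
  have hGs : ∀ y, Summable fun k => evenSq q k y := fun y =>
    Summable.of_nonneg_of_le (fun k => hG0 k y) (fun k => hGle k y)
      (hwsum.summable.mul_right _)
  have hGconv : ∀ k, ConvexOn ℝ Set.univ (evenSq q k) := by
    intro k
    have h1 : ConvexOn ℝ Set.univ fun y => q k y ^ 2 := (hqc k).pow (fun y _ => hq0 k y) 2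
    have h2 : ConvexOn ℝ Set.univ fun y => q k (-y) ^ 2 := by
      have := h1.comp_linearMap (-LinearMap.id : E →ₗ[ℝ] E)
      simpa [Function.comp_def] using this
    exact (h1.add h2).smul (hw k).le
  have hGlip1 : ∀ k a b, evenSq q k a - evenSq q k b ≤
      (1 / 2 : ℝ) ^ (k + 1) * ((2 + ‖a‖ + ‖b‖) * ‖a - b‖) := by
    have hsq : ∀ k a b, q k a ^ 2 - q k b ^ 2 ≤ (2 + ‖a‖ + ‖b‖) * ‖a - b‖ := by
      intro k a b
      have h1 := hql k a b
      have h2 := hqle k a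
      have h3 := hqle k b
      have h4 := hq0 k a
      have h5 := hq0 k b
      have h6 := norm_nonneg (a - b)
      have h7 := norm_nonneg a
      have h8 := norm_nonneg b
      calc q k a ^ 2 - q k b ^ 2 = (q k a + q k b) * (q k a - q k b) := by ring
        _ ≤ (q k a + q k b) * ‖a - b‖ := by gcongr; linarith
        _ ≤ _ := mul_le_mul_of_nonneg_right (by linarith) h6
    intro k a b
    have h1 := hsq k a b
    have h2 := hsq k (-a) (-b)
    have h3 : -a - -b = -(a - b) := by abel
    rw [h3, norm_neg, norm_neg, norm_neg] at h2
    have := hw k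
    calc evenSq q k a - evenSq q k b = (1 / 2 : ℝ) ^ (k + 1) / 8 *
          ((q k a ^ 2 - q k b ^ 2) + (q k (-a) ^ 2 - q k (-b) ^ 2)) := by unfold evenSq; ring
      _ ≤ (1 / 2 : ℝ) ^ (k + 1) / 8 *
          (((2 + ‖a‖ + ‖b‖) * ‖a - b‖) + ((2 + ‖a‖ + ‖b‖) * ‖a - b‖)) := by gcongr
      _ ≤ (1 / 2 : ℝ) ^ (k + 1) / 8 * (8 * ((2 + ‖a‖ + ‖b‖) * ‖a - b‖)) := by
          gcongr
          have : 0 ≤ (2 + ‖a‖ + ‖b‖) * ‖a - b‖ := by positivity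
          linarith
      _ = _ := by ring
  have hGlsc : ∀ k, LSCAlong N (evenSq q k) := fun k =>
    (((hqlsc k).sq (hq0 k)).add (((hqlsc k).comp_neg hN).sq fun y => hq0 k (-y))).const_mul (hw k)
  set Φ : E → ℝ := fun y => ‖y‖ ^ 2 + ∑' k, evenSq q k y with hΦ
  have hlip1 : ∀ a b, Φ a - Φ b ≤ 4 * (2 + ‖a‖ + ‖b‖) * ‖a - b‖ := by
    intro a b
    have h1 : ‖a‖ ^ 2 - ‖b‖ ^ 2 ≤ (‖a‖ + ‖b‖) * ‖a - b‖ := by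
      have := norm_sub_norm_le a b
      have h7 := norm_nonneg a
      have h8 := norm_nonneg b
      calc ‖a‖ ^ 2 - ‖b‖ ^ 2 = (‖a‖ + ‖b‖) * (‖a‖ - ‖b‖) := by ring
        _ ≤ _ := by gcongr
    have h2 : ∑' k, evenSq q k a - ∑' k, evenSq q k b ≤ (2 + ‖a‖ + ‖b‖) * ‖a - b‖ := by
      rw [← (hGs a).tsum_sub (hGs b)]
      have h3 := hwsum.mul_right ((2 + ‖a‖ + ‖b‖) * ‖a - b‖)
      rw [one_mul] at h3
      exact hasSum_le (fun k => hGlip1 k a b) ((hGs a).sub (hGs b)).hasSum h3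
    have h4 : 0 ≤ ‖a‖ * ‖a - b‖ := by positivity
    have h5 : 0 ≤ ‖b‖ * ‖a - b‖ := by positivity
    have h6 := norm_nonneg (a - b)
    simp only [hΦ]
    nlinarith
  have hnormconv : ConvexOn ℝ Set.univ fun y : E => ‖y‖ ^ 2 :=
    convexOn_univ_norm.pow (fun y _ => norm_nonneg y) 2
  refine exists_LUR_seminorm_of_convex_even N hN Φ ?_ ?_ ?_ ?_ ?_ ?_ ?_
  · refine hnormconv.add ⟨convex_univ, fun x _ y _ a b ha hb hab => ?_⟩
    simp only [smul_eq_mul]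
    rw [← tsum_mul_left, ← tsum_mul_left,
      ← ((hGs x).mul_left a).tsum_add ((hGs y).mul_left b)]
    exact (hGs _).tsum_le_tsum (fun k => by
      simpa using (hGconv k).2 (Set.mem_univ x) (Set.mem_univ y) ha hb hab)
      (((hGs x).mul_left a).add ((hGs y).mul_left b))
  · intro y
    simp only [hΦ, norm_neg, evenSq, neg_neg, add_comm]
  · intro y
    exact le_add_of_nonneg_right (tsum_nonneg fun k => hG0 k y)
  · intro a b
    refine abs_sub_le_iff.2 ⟨hlip1 a b, ?_⟩
    have := hlip1 b a
    rw [norm_sub_rev b a, add_right_comm] at this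
    exact this
  -- The factor 1/8 in `evenSq` is what brings the sum at 0 down to 1/4.
  · have h1 := (hwsum.mul_right ((1 + ‖(0 : E)‖) ^ 2 / 4))
    have h2 := (hGs 0).tsum_le_tsum (fun k => hGle k 0) h1.summable
    rw [h1.tsum_eq] at h2
    simp only [hΦ]
    simp only [norm_zero] at h2 ⊢
    linarith
  · exact (hnorm.sq fun y => norm_nonneg y).add (LSCAlong.tsum hGlsc hG0 hGs)
  · intro x y hgap
    have hgapk : ∀ k n, (1 / 2 : ℝ) ^ (k + 1) / 8 * ((q k x ^ 2 + q k (y n) ^ 2) / 2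
        - q k ((1 / 2 : ℝ) • (x + y n)) ^ 2) ≤
        (Φ x + Φ (y n)) / 2 - Φ ((1 / 2 : ℝ) • (x + y n)) := by
      intro k n
      set m := (1 / 2 : ℝ) • (x + y n) with hm
      have hmid : ∀ (g : E → ℝ), ConvexOn ℝ Set.univ g → 0 ≤ (g x + g (y n)) / 2 - g m := by
        intro g hg
        have h := hg.2 (Set.mem_univ x) (Set.mem_univ (y n)) (show (0 : ℝ) ≤ 1 / 2 by norm_num)
          (show (0 : ℝ) ≤ 1 / 2 by norm_num) (by norm_num)
        rw [← smul_add] at h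
        simp only [smul_eq_mul] at h
        rw [hm]
        linarith
      have hsum : Summable fun k => (evenSq q k x + evenSq q k (y n)) / 2 - evenSq q k m :=
        (((hGs x).add (hGs (y n))).div_const 2).sub (hGs m)
      -- All midpoint gaps are nonnegative by convexity, so each single one is dominated by the gap
      -- of `Φ`.
      have h1 := hsum.le_tsum k fun j _ => hmid _ (hGconv j)
      have h2 : ∑' k, ((evenSq q k x + evenSq q k (y n)) / 2 - evenSq q k m) =
          (∑' k, evenSq q k x + ∑' k, evenSq q k (y n)) / 2 - ∑' k, evenSq q k m := by
        rw [(((hGs x).add (hGs (y n))).div_const 2).tsum_sub (hGs m), tsum_div_const,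
          (hGs x).tsum_add (hGs (y n))]
      have h3 := hmid _ hnormconv
      have h4 : (1 / 2 : ℝ) ^ (k + 1) / 8 * ((q k x ^ 2 + q k (y n) ^ 2) / 2 - q k m ^ 2) ≤
          (evenSq q k x + evenSq q k (y n)) / 2 - evenSq q k m := by
        have h5 := (sq_nonneg _).trans
          (midpoint_gap_nonneg (fun z => hq0 k (-z)) (by
            have := (hqc k).comp_linearMap (-LinearMap.id : E →ₗ[ℝ] E)
            simpa [Function.comp_def] using this) x (y n))
        have h6 := mul_nonneg (hw k).le h5
        unfold evenSq
        rw [← hm] at h6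
        linarith
      simp only [hΦ]
      linarith
    have hgap0 : ∀ k, Tendsto (fun n => (q k x ^ 2 + q k (y n) ^ 2) / 2
        - q k ((1 / 2 : ℝ) • (x + y n)) ^ 2) atTop (𝓝 0) := by
      intro k
      have h1 := hgap.const_mul ((1 / 2 : ℝ) ^ (k + 1) / 8)⁻¹
      rw [mul_zero] at h1
      refine squeeze_zero (fun n => (sq_nonneg _).trans
        (midpoint_gap_nonneg (hq0 k) (hqc k) x (y n))) (fun n => ?_) h1
      rw [le_inv_mul_iff₀ (hw k)]
      exact hgapk k n
    have hq : ∀ k, Tendsto (fun n => q k (y n)) atTop (𝓝 (q k x)) := by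
      intro k
      have h1 : Tendsto (fun n => ((q k x - q k (y n)) / 2) ^ 2) atTop (𝓝 0) :=
        squeeze_zero (fun n => sq_nonneg _)
          (fun n => midpoint_gap_nonneg (hq0 k) (hqc k) x (y n)) (hgap0 k)
      have h2 := (h1.sqrt).const_mul 2
      simp only [Real.sqrt_sq_eq_abs, Real.sqrt_zero, mul_zero] at h2
      rw [tendsto_iff_norm_sub_tendsto_zero]
      refine h2.congr fun n => ?_
      rw [abs_div, abs_two, Real.norm_eq_abs, abs_sub_comm]
      ring
    refine hrot x y hq fun k => ?_
    have h1 := (((hq k).pow 2).const_add (q k x ^ 2)).div_const 2 |>.sub (hgap0 k)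
    have h2 := h1.sqrt
    simp only [sub_sub_cancel, sub_zero, add_self_div_two] at h2
    simpa only [Real.sqrt_sq (hq0 k _)] using h2

/-- A countable family of convex Lipschitz functions that detects norm convergence (in the rotund
sense) yields an equivalent LUR norm. -/
theorem exists_LUR_seminorm_of_family (N : E → Filter E)
    (hN : ∀ (c : ℝ) (y : E), Tendsto (fun z : E => c • z) (N y) (N (c • y)))
    (hnorm : LSCAlong N fun y => ‖y‖) {ι : Type*} [Countable ι] [Nonempty ι] (p : ι → E → ℝ)
    (hp0 : ∀ k y, 0 ≤ p k y) (hpc : ∀ k, ConvexOn ℝ Set.univ (p k))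
    (hpl : ∀ k, ∃ C, 0 ≤ C ∧ ∀ a b, p k a ≤ p k b + C * ‖a - b‖)
    (hplsc : ∀ k, LSCAlong N (p k))
    (hrot : ∀ (x : E) (y : ℕ → E), (∀ k, Tendsto (fun n => p k (y n)) atTop (𝓝 (p k x))) →
      (∀ k, Tendsto (fun n => p k ((1 / 2 : ℝ) • (x + y n))) atTop (𝓝 (p k x))) →
      Tendsto y atTop (𝓝 x)) :
    ∃ ν : Seminorm ℝ E, IsEquivalentNorm ν ∧ LSCAlong N ν ∧ IsLUR ν := by
  obtain ⟨e, he⟩ := exists_surjective_nat ι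
  choose C hC0 hC using hpl
  have hpos : ∀ k, 0 < 1 + C k + p k 0 := fun k => by linarith [hC0 k, hp0 k 0]
  refine exists_LUR_seminorm_of_normalized_family N hN hnorm
    (fun k y => (1 + C (e k) + p (e k) 0)⁻¹ * p (e k) y)
    (fun k y => mul_nonneg (inv_nonneg.2 (hpos _).le) (hp0 _ _)) ?_ ?_ ?_ ?_ ?_
  · intro k
    exact (hpc (e k)).smul (inv_nonneg.2 (hpos _).le)
  · intro k a b
    rw [inv_mul_le_iff₀ (hpos _), mul_add, mul_inv_cancel_left₀ (hpos _).ne']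
    have := hC (e k) a b
    have h2 := mul_nonneg (show 0 ≤ 1 + p (e k) 0 by linarith [hp0 (e k) 0]) (norm_nonneg (a - b))
    linarith
  · intro k
    rw [inv_mul_le_iff₀ (hpos _)]
    linarith [hC0 (e k)]
  · intro k
    exact (hplsc (e k)).const_mul (inv_pos.2 (hpos _))
  · intro x y h1 h2
    have hback : ∀ k (u : ℕ → E), Tendsto (fun n => (1 + C (e k) + p (e k) 0)⁻¹ * p (e k) (u n))
        atTop (𝓝 ((1 + C (e k) + p (e k) 0)⁻¹ * p (e k) x)) →
        Tendsto (fun n => p (e k) (u n)) atTop (𝓝 (p (e k) x)) := by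
      intro k u hu
      have := hu.const_mul (1 + C (e k) + p (e k) 0)
      simpa only [mul_inv_cancel_left₀ (hpos _).ne'] using this
    refine hrot x y (fun k => ?_) fun k => ?_
    · obtain ⟨k, rfl⟩ := he k
      exact hback k _ (h1 k)
    · obtain ⟨k, rfl⟩ := he k
      exact hback k _ (h2 k)

end LURFamily

/-! ### Countable slicings: strong slices and composition. -/

section Slices

variable {E : Type*} [NormedAddCommGroup E] [NormedSpace ℝ E]

/-- `X` is covered by countably many pieces such that every point `x` of a piece `A` lies in a slice
of `A`, given by a functional in `F`, on which the relation `R` holds. -/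
def SliceCover (F : Submodule ℝ (E →L[ℝ] ℝ)) (X : Set E) (R : E → E → Prop) : Prop :=
  ∃ A : ℕ → Set E, X ⊆ ⋃ n, A n ∧ ∀ n, ∀ x ∈ A n, ∃ f ∈ F, ∃ c < f x,
    ∀ y ∈ A n, ∀ z ∈ A n, c < f y → c < f z → R y z

/-- The slice `{c < h}` of `A` is a normalised slice on which `R` holds, and `x` is close to its
top. -/
def IsStrongSlice (F : Submodule ℝ (E →L[ℝ] ℝ)) (A : Set E) (R : E → E → Prop) (η : ℝ) (x : E)
    (h : E →L[ℝ] ℝ) (c : ℝ) : Prop :=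
  h ∈ F ∧ 1 - η < h x - c ∧ (∀ y ∈ A, h y - c ≤ 1) ∧
    ∀ y ∈ A, ∀ z ∈ A, c < h y → c < h z → R y z

variable {F : Submodule ℝ (E →L[ℝ] ℝ)} {X : Set E} {R S : E → E → Prop}

theorem SliceCover.of_countable {ι : Type*} [Countable ι] (A : ι → Set E) (hX : X ⊆ ⋃ i, A i)
    (hA : ∀ i, ∀ x ∈ A i, ∃ f ∈ F, ∃ c < f x, ∀ y ∈ A i, ∀ z ∈ A i, c < f y → c < f z → R y z) :
    SliceCover F X R := by
  rcases isEmpty_or_nonempty ι with h | h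
  · refine ⟨fun _ => ∅, fun x hx => ?_, fun n x hx => hx.elim⟩
    obtain ⟨i, -⟩ := Set.mem_iUnion.1 (hX hx)
    exact isEmptyElim i
  · obtain ⟨e, he⟩ := exists_surjective_nat ι
    refine ⟨fun n => A (e n), fun x hx => ?_, fun n => hA (e n)⟩
    obtain ⟨i, hi⟩ := Set.mem_iUnion.1 (hX hx)
    obtain ⟨n, rfl⟩ := he i
    exact Set.mem_iUnion.2 ⟨n, hi⟩

theorem SliceCover.iUnion {ι : Type*} [Countable ι] {X : ι → Set E}
    (h : ∀ i, SliceCover F (X i) R) : SliceCover F (⋃ i, X i) R := by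
  choose A hA hA' using h
  refine SliceCover.of_countable (fun p : ι × ℕ => A p.1 p.2) (fun x hx => ?_) fun p => hA' p.1 p.2
  obtain ⟨i, hi⟩ := Set.mem_iUnion.1 hx
  obtain ⟨n, hn⟩ := Set.mem_iUnion.1 (hA i hi)
  exact Set.mem_iUnion.2 ⟨(i, n), hn⟩

theorem SliceCover.mono_inter (h : SliceCover F X R) (hRS : ∀ y ∈ X, ∀ z ∈ X, R y z → S y z) :
    SliceCover F X S := by
  obtain ⟨A, hA, hA'⟩ := h
  refine ⟨fun n => A n ∩ X, fun x hx => ?_, fun n x hx => ?_⟩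
  · obtain ⟨n, hn⟩ := Set.mem_iUnion.1 (hA hx)
    exact Set.mem_iUnion.2 ⟨n, hn, hx⟩
  · obtain ⟨f, hf, c, hc, h⟩ := hA' n x hx.1
    exact ⟨f, hf, c, hc, fun y hy z hz hcy hcz => hRS y hy.2 z hz.2 (h y hy.1 z hz.1 hcy hcz)⟩

/-- The points left over after `k` rounds of removing the points in strong slices. -/
def sliceDerivative (F : Submodule ℝ (E →L[ℝ] ℝ)) (A : Set E) (R : E → E → Prop) (η : ℝ) :
    ℕ → Set E
  | 0 => A
  | k + 1 => {x ∈ sliceDerivative F A R η k |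
      ¬∃ h c, IsStrongSlice F (sliceDerivative F A R η k) R η x h c}

theorem sliceDerivative_subset (A : Set E) (η : ℝ) (k : ℕ) : sliceDerivative F A R η k ⊆ A := by
  induction k with
  | zero => exact subset_rfl
  | succ k ih => exact (Set.sep_subset _ _).trans ih

/-- Each round removes the points near the top of the given slice, so the height of `f` above `c`
shrinks at least by the factor `1 - η`. A point with `c < f x` cannot survive all rounds. -/
theorem exists_mem_isStrongSlice {A : Set E} {B η : ℝ} (hη : 0 < η) (hη1 : η < 1)
    (hB : ∀ y ∈ A, ‖y‖ ≤ B) {x : E} (hx : x ∈ A)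
    (hslice : ∃ f ∈ F, ∃ c < f x, ∀ y ∈ A, ∀ z ∈ A, c < f y → c < f z → R y z) :
    ∃ k, x ∈ sliceDerivative F A R η k ∧
      ∃ h c, IsStrongSlice F (sliceDerivative F A R η k) R η x h c := by
  by_contra hcon
  push Not at hcon
  have hmem : ∀ k, x ∈ sliceDerivative F A R η k := by
    intro k
    induction k with
    | zero => exact hx
    | succ k ih =>
      refine ⟨ih, ?_⟩
      push Not
      exact hcon k ih
  obtain ⟨f, hf, c, hc, hR⟩ := hslice
  set b : ℝ := max (‖f‖ * B - c) 1 with hb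
  have hb0 : 0 < b := lt_max_of_lt_right one_pos
  have hq : 0 < 1 - η := by linarith
  have hbound : ∀ k, ∀ y ∈ sliceDerivative F A R η k, f y - c ≤ (1 - η) ^ k * b := by
    intro k
    induction k with
    | zero =>
      intro y hy
      have h1 : f y ≤ ‖f‖ * ‖y‖ := (le_abs_self _).trans (f.le_opNorm y)
      have h2 := mul_le_mul_of_nonneg_left (hB y hy) (norm_nonneg f)
      have h3 := le_max_left (‖f‖ * B - c) 1
      simp only [pow_zero, one_mul]
      linarith
    | succ k ih =>
      intro y hy
      by_contra hlt
      rw [not_le] at hlt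
      have hβ : 0 < (1 - η) ^ k * b := by positivity
      set β := (1 - η) ^ k * b with hβdef
      -- Rescaled by the height bound `β` of round `k`, the slice is strong and has `y` near its
      -- top, so `y` should have been removed.
      refine hy.2 ⟨β⁻¹ • f, β⁻¹ * c, F.smul_mem _ hf, ?_, fun z hz => ?_, ?_⟩
      · rw [smul_apply, smul_eq_mul, ← mul_sub, lt_inv_mul_iff₀ hβ]
        rw [pow_succ] at hlt
        linarith
      · rw [smul_apply, smul_eq_mul, ← mul_sub, inv_mul_le_iff₀ hβ, mul_one]
        exact ih z hz
      · intro z hz w hw hcz hcw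
        simp only [smul_apply, smul_eq_mul] at hcz hcw
        exact hR z (sliceDerivative_subset A η k hz) w (sliceDerivative_subset A η k hw)
          (lt_of_mul_lt_mul_left hcz (inv_nonneg.2 hβ.le))
          (lt_of_mul_lt_mul_left hcw (inv_nonneg.2 hβ.le))
  have hlim : Tendsto (fun k => (1 - η) ^ k * b) atTop (𝓝 0) := by
    simpa using (tendsto_pow_atTop_nhds_zero_of_lt_one hq.le (by linarith)).mul_const b
  have := ge_of_tendsto' hlim fun k => hbound k x (hmem k)
  linarith

/-- Slices can be improved to strong slices of bounded pieces. -/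
theorem SliceCover.exists_strong (h : SliceCover F X R) {η : ℝ} (hη : 0 < η) (hη1 : η < 1) :
    ∃ A : ℕ → Set E, X ⊆ ⋃ n, A n ∧ ∀ n, (∃ B, ∀ y ∈ A n, ‖y‖ ≤ B) ∧
      ∀ x ∈ A n, ∃ h c, IsStrongSlice F (A n) R η x h c := by
  obtain ⟨A, hA, hA'⟩ := h
  obtain ⟨e, he⟩ := exists_surjective_nat ((ℕ × ℕ) × ℕ)
  let A₁ : ℕ × ℕ → Set E := fun p => A p.1 ∩ {y | ‖y‖ ≤ p.2}
  let A₂ : (ℕ × ℕ) × ℕ → Set E := fun p => {x ∈ sliceDerivative F (A₁ p.1) R η p.2 |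
    ∃ h c, IsStrongSlice F (sliceDerivative F (A₁ p.1) R η p.2) R η x h c}
  refine ⟨fun n => A₂ (e n), fun x hx => ?_, fun n => ⟨⟨(e n).1.2, fun y hy => ?_⟩, ?_⟩⟩
  · obtain ⟨n, hn⟩ := Set.mem_iUnion.1 (hA hx)
    obtain ⟨B, hB⟩ := exists_nat_ge ‖x‖
    obtain ⟨f, hf, c, hc, hR⟩ := hA' n x hn
    obtain ⟨k, hk⟩ := exists_mem_isStrongSlice (F := F) (R := R) (A := A₁ (n, B)) (B := B) hη hη1
      (fun y hy => hy.2) ⟨hn, hB⟩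
      ⟨f, hf, c, hc, fun y hy z hz => hR y hy.1 z hz.1⟩
    obtain ⟨m, hm⟩ := he ((n, B), k)
    refine Set.mem_iUnion.2 ⟨m, ?_⟩
    rw [hm]
    exact hk
  · exact (sliceDerivative_subset _ _ _ hy.1).2
  · rintro x ⟨hx, h, c, hF, h1, h2, h3⟩
    exact ⟨h, c, hF, h1, fun y hy => h2 y hy.1, fun y hy z hz => h3 y hy.1 z hz.1⟩

/-- Composition of slicings: if `R` can be sliced, and `S` can be sliced relative to `R`, with
parameters in a countable set, then `S` can be sliced. -/
theorem SliceCover.comp (hR : SliceCover F X R) {κ : Type*} [Countable κ] (code : E → κ)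
    (hS : ∀ x ∈ X, ∃ f ∈ F, ∃ c < f x, ∀ y ∈ X, code y = code x → R x y → c < f y → S x y)
    (hSS : ∀ x y z, S x y → S x z → S y z) : SliceCover F X S := by
  have hη : ∀ j : ℕ, (0 : ℝ) < 1 / (4 * ((j : ℝ) + 1) ^ 3) ∧ 1 / (4 * ((j : ℝ) + 1) ^ 3) < 1 := by
    intro j
    have : (1 : ℝ) ≤ ((j : ℝ) + 1) ^ 3 := one_le_pow₀ (by linarith [Nat.cast_nonneg (α := ℝ) j])
    refine ⟨by positivity, ?_⟩
    rw [div_lt_one (by positivity)]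
    linarith
  choose A hA hA' using fun j => hR.exists_strong (hη j).1 (hη j).2
  let A₂ : κ × ℕ → Set E := fun p => {x ∈ X | code x = p.1 ∧ ‖x‖ ≤ (p.2 : ℝ) + 1 ∧
    ∃ f ∈ F, ‖f‖ ≤ (p.2 : ℝ) + 1 ∧ ∃ c, c + 1 / ((p.2 : ℝ) + 1) ≤ f x ∧
      ∀ y ∈ X, code y = code x → R x y → c < f y → S x y}
  refine SliceCover.of_countable (fun p : (κ × ℕ) × ℕ => A p.1.2 p.2 ∩ A₂ p.1)
    (fun x hx => ?_) ?_
  · obtain ⟨f, hf, c, hc, h⟩ := hS x hx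
    obtain ⟨j₁, h₁⟩ := exists_nat_ge ‖x‖
    obtain ⟨j₂, h₂⟩ := exists_nat_ge ‖f‖
    obtain ⟨j₃, h₃⟩ := exists_nat_ge (1 / (f x - c))
    set j := j₁ + j₂ + j₃ with hj
    have hj' : (j : ℝ) = j₁ + j₂ + j₃ := by rw [hj]; push_cast; ring
    have k1 := Nat.cast_nonneg (α := ℝ) j₁
    have k2 := Nat.cast_nonneg (α := ℝ) j₂
    have k3 := Nat.cast_nonneg (α := ℝ) j₃
    obtain ⟨n, hn⟩ := Set.mem_iUnion.1 (hA j hx)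
    refine Set.mem_iUnion.2 ⟨((code x, j), n), hn, hx, rfl, by simp only; linarith, f, hf,
      by simp only; linarith, c, ?_, h⟩
    have hpos : 0 < f x - c := sub_pos.2 hc
    have : 1 / ((j : ℝ) + 1) ≤ f x - c := by
      rw [div_le_iff₀ (by positivity)]
      rw [div_le_iff₀ hpos] at h₃
      nlinarith
    simp only
    linarith
  · rintro ⟨⟨κ₀, j⟩, n⟩ x ⟨hxA, hxX, hcode, hxj, f, hf, hfj, c₂, hc₂, hxS⟩
    obtain ⟨h, c, hh, h1, h2, h3⟩ := (hA' j n).2 x hxA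
    simp only at hcode hxj hfj hc₂
    set J : ℝ := (j : ℝ) + 1 with hJ
    have hJ1 : 1 ≤ J := by linarith [Nat.cast_nonneg (α := ℝ) j]
    have hJ0 : 0 < J := by linarith
    -- `θ` makes `θ • f` at most 1/4 in modulus on the ball of radius `J`. The slack of the strong
    -- slices, 1/(4J³), is `θ` times the margin 1/J by which `f x` exceeds `c₂`.
    set θ : ℝ := 1 / (4 * J ^ 2) with hθ
    have hθ0 : 0 < θ := by positivity
    have hfbd : ∀ y : E, ‖y‖ ≤ J → |θ * f y| ≤ 1 / 4 := by
      intro y hy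
      have h4 : |f y| ≤ J * J := (f.le_opNorm y).trans (by gcongr)
      rw [abs_mul, abs_of_pos hθ0]
      calc θ * |f y| ≤ θ * (J * J) := by gcongr
        _ = 1 / 4 := by rw [hθ]; field_simp
    have hηJ : 1 / (4 * J ^ 3) ≤ 1 / 4 := by
      have : 1 ≤ J ^ 3 := one_le_pow₀ hJ1
      exact one_div_le_one_div_of_le (by norm_num) (by linarith)
    have hθη : θ * (1 / J) = 1 / (4 * J ^ 3) := by rw [hθ]; field_simp
    -- The perturbation `θ • f` is too small to leave the slice of `h`; and since `h y - c ≤ 1`,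
    -- nearly the top height, `f y` cannot fall below `f x` by 1/J or more.
    have hkey : ∀ y ∈ A j n ∩ A₂ (κ₀, j), c + (1 - 1 / (4 * J ^ 3)) + θ * f x < h y + θ * f y →
        c < h y ∧ c₂ < f y := by
      rintro y ⟨hyA, -, -, hyj, -⟩ hlt
      have hx4 := abs_le.1 (hfbd x hxj)
      have hy4 := abs_le.1 (hfbd y hyj)
      refine ⟨by linarith, ?_⟩
      have h5 := h2 y hyA
      have h6 : θ * (f x - 1 / J) < θ * f y := by
        rw [mul_sub, hθη]
        linarith
      have := lt_of_mul_lt_mul_left h6 hθ0.le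
      linarith
    refine ⟨h + θ • f, F.add_mem hh (F.smul_mem _ hf),
      c + (1 - 1 / (4 * J ^ 3)) + θ * f x, ?_, ?_⟩
    · simp only [add_apply, smul_apply, smul_eq_mul]
      linarith
    · intro y hy z hz hcy hcz
      simp only [add_apply, smul_apply, smul_eq_mul]
        at hcy hcz
      have hxc : c < h x := by linarith
      have hy' := hkey y hy hcy
      have hz' := hkey z hz hcz
      exact hSS x y z
        (hxS y hy.2.1 (hy.2.2.1.trans hcode.symm) (h3 x hxA y hy.1 hxc hy'.1) hy'.2)
        (hxS z hz.2.1 (hz.2.2.1.trans hcode.symm) (h3 x hxA z hz.1 hxc hz'.1) hz'.2)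

end Slices

/-! ### From slice covers to LUR norms. -/

section SupAffine

variable {E : Type*} [NormedAddCommGroup E] [NormedSpace ℝ E]

/-- The supremum of the positive parts of a set of affine functions `f - b`. -/
noncomputable def supAffine (S : Set ((E →L[ℝ] ℝ) × ℝ)) (y : E) : ℝ :=
  ⨆ p : S, max 0 (p.1.1 y - p.1.2)

variable {S : Set ((E →L[ℝ] ℝ) × ℝ)} {j : ℝ}

theorem supAffine_nonneg (S : Set ((E →L[ℝ] ℝ) × ℝ)) (y : E) : 0 ≤ supAffine S y :=
  Real.iSup_nonneg fun _ => le_max_left _ _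

theorem supAffine_le {y : E} {c : ℝ} (hc : 0 ≤ c) (h : ∀ p ∈ S, p.1 y - p.2 ≤ c) :
    supAffine S y ≤ c :=
  Real.iSup_le (fun p => max_le hc (h p.1 p.2)) hc

theorem le_supAffine (hS : ∀ p ∈ S, ‖p.1‖ ≤ j ∧ |p.2| ≤ j) {p : (E →L[ℝ] ℝ) × ℝ} (hp : p ∈ S)
    (y : E) : p.1 y - p.2 ≤ supAffine S y := by
  have hbdd : BddAbove (Set.range fun p : S => max 0 (p.1.1 y - p.1.2)) := by
    refine ⟨max 0 (j * ‖y‖ + j), ?_⟩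
    rintro _ ⟨q, rfl⟩
    refine max_le_max le_rfl ?_
    have h1 : q.1.1 y ≤ ‖q.1.1‖ * ‖y‖ := (le_abs_self _).trans (q.1.1.le_opNorm y)
    have h2 := mul_le_mul_of_nonneg_right (hS q.1 q.2).1 (norm_nonneg y)
    have h3 := (abs_le.1 (hS q.1 q.2).2).1
    linarith
  exact (le_max_right _ _).trans (le_ciSup hbdd ⟨p, hp⟩)

theorem exists_lt_of_lt_supAffine {y : E} {c : ℝ} (hc : 0 ≤ c) (h : c < supAffine S y) :
    ∃ p ∈ S, c < p.1 y - p.2 := by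
  by_contra hcon
  push Not at hcon
  exact h.not_ge (supAffine_le hc hcon)

theorem convexOn_supAffine (hS : ∀ p ∈ S, ‖p.1‖ ≤ j ∧ |p.2| ≤ j) :
    ConvexOn ℝ Set.univ (supAffine S) := by
  refine ⟨convex_univ, fun x _ y _ a b ha hb hab => supAffine_le ?_ fun p hp => ?_⟩
  · have := supAffine_nonneg S x
    have := supAffine_nonneg S y
    simp only [smul_eq_mul]
    positivity
  · have h1 := mul_le_mul_of_nonneg_left (le_supAffine hS hp x) ha
    have h2 := mul_le_mul_of_nonneg_left (le_supAffine hS hp y) hb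
    simp only [map_add, map_smul, smul_eq_mul]
    have h3 : p.2 = a * p.2 + b * p.2 := by rw [← add_mul, hab, one_mul]
    linarith

theorem supAffine_lipschitz (hj : 0 ≤ j) (hS : ∀ p ∈ S, ‖p.1‖ ≤ j ∧ |p.2| ≤ j) (x y : E) :
    supAffine S x ≤ supAffine S y + j * ‖x - y‖ := by
  refine supAffine_le (add_nonneg (supAffine_nonneg S y) (by positivity)) fun p hp => ?_
  have h1 := le_supAffine hS hp y
  have h2 : p.1 (x - y) ≤ ‖p.1‖ * ‖x - y‖ := (le_abs_self _).trans (p.1.le_opNorm _)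
  have h3 := mul_le_mul_of_nonneg_right (hS p hp).1 (norm_nonneg (x - y))
  rw [map_sub] at h2
  linarith

theorem lscAlong_supAffine {N : E → Filter E} {F : Submodule ℝ (E →L[ℝ] ℝ)}
    (hF : ∀ f ∈ F, ∀ y, Tendsto f (N y) (𝓝 (f y))) (hS : ∀ p ∈ S, ‖p.1‖ ≤ j ∧ |p.2| ≤ j)
    (hSF : ∀ p ∈ S, p.1 ∈ F) : LSCAlong N (supAffine S) := by
  intro y c hc
  rcases lt_or_ge c 0 with h | h
  · exact Eventually.of_forall fun z => h.trans_le (supAffine_nonneg S z)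
  obtain ⟨p, hp, hcp⟩ := exists_lt_of_lt_supAffine h hc
  have h1 := (hF p.1 (hSF p hp) y).eventually (lt_mem_nhds (show c + p.2 < p.1 y by linarith))
  filter_upwards [h1] with z hz
  have := le_supAffine hS hp z
  linarith

/-- If the functionals of `F` are continuous along `N` and norming, and for each `ε` the space can
be covered by countably many pieces with slices of diameter at most `ε`, then there is an equivalent
LUR norm that is lower semicontinuous along `N`. -/
theorem exists_LUR_seminorm_of_sliceCover (N : E → Filter E)
    (hN : ∀ (c : ℝ) (y : E), Tendsto (fun z : E => c • z) (N y) (N (c • y)))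
    (F : Submodule ℝ (E →L[ℝ] ℝ)) (hF : ∀ f ∈ F, ∀ y, Tendsto f (N y) (𝓝 (f y)))
    (hnorming : ∀ (x : E) (c : ℝ), 0 ≤ c → (∀ f ∈ F, ‖f‖ ≤ 1 → f x ≤ c) → ‖x‖ ≤ c)
    (hcover : ∀ ε > 0, SliceCover F Set.univ fun y z => ‖y - z‖ ≤ ε) :
    ∃ ν : Seminorm ℝ E, IsEquivalentNorm ν ∧ LSCAlong N ν ∧ IsLUR ν := by
  have hnormlsc : LSCAlong N fun y => ‖y‖ := by
    intro y c hc
    rcases lt_or_ge c 0 with h | h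
    · exact Eventually.of_forall fun z => h.trans_le (norm_nonneg z)
    have : ∃ f ∈ F, ‖f‖ ≤ 1 ∧ c < f y := by
      by_contra hcon
      push Not at hcon
      exact hc.not_ge (hnorming y c h hcon)
    obtain ⟨f, hf, hf1, hcf⟩ := this
    filter_upwards [(hF f hf y).eventually (lt_mem_nhds hcf)] with z hz
    calc c < f z := hz
      _ ≤ ‖f‖ * ‖z‖ := (le_abs_self _).trans (f.le_opNorm z)
      _ ≤ 1 * ‖z‖ := by gcongr
      _ = ‖z‖ := one_mul _
  -- In `p = (i, l)`, the diameter is 1/(i+1) and `l` bounds the norm. The slack is small enough to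
  -- be multiplied by the diameter `2 * l` of the ball at the end.
  have hη : ∀ p : ℕ × ℕ, (0 : ℝ) < 1 / (((p.1 : ℝ) + 2) * ((p.2 : ℝ) + 1)) ∧
      1 / (((p.1 : ℝ) + 2) * ((p.2 : ℝ) + 1)) ≤ 1 / 2 := fun p => by
    have h1 := Nat.cast_nonneg (α := ℝ) p.1
    have h2 := Nat.cast_nonneg (α := ℝ) p.2
    refine ⟨by positivity, one_div_le_one_div_of_le (by norm_num) ?_⟩
    nlinarith
  choose A hA hA' using fun p : ℕ × ℕ =>
    (hcover (1 / ((p.1 : ℝ) + 1)) (by positivity)).exists_strong (hη p).1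
      ((hη p).2.trans_lt (by norm_num))
  let D : ℕ × ℕ → ℕ → Set E := fun p n => A p n ∩ {y | ‖y‖ ≤ p.2}
  -- `S₁` collects the normalised slices of small diameter. `S₂` collects half-spaces containing the
  -- piece: the `y n` need not lie in the piece, and the supremum over `S₂` measures how far they
  -- are from its convex hull.
  let S₁ : (ℕ × ℕ) × ℕ × ℕ → Set ((E →L[ℝ] ℝ) × ℝ) := fun q => {p | p.1 ∈ F ∧ ‖p.1‖ ≤ q.2.2 ∧
    |p.2| ≤ q.2.2 ∧ (∀ y ∈ D q.1 q.2.1, p.1 y - p.2 ≤ 1) ∧ ∀ y ∈ D q.1 q.2.1, ∀ z ∈ D q.1 q.2.1,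
      p.2 < p.1 y → p.2 < p.1 z → ‖y - z‖ ≤ 1 / ((q.1.1 : ℝ) + 1)}
  let S₂ : (ℕ × ℕ) × ℕ × ℕ → Set ((E →L[ℝ] ℝ) × ℝ) := fun q => {p | p.1 ∈ F ∧ ‖p.1‖ ≤ q.2.2 ∧
    |p.2| ≤ q.2.2 ∧ ∀ y ∈ D q.1 q.2.1, p.1 y ≤ p.2}
  let T : Bool × (ℕ × ℕ) × ℕ × ℕ → Set ((E →L[ℝ] ℝ) × ℝ) := fun r =>
    if r.1 then S₁ r.2 else S₂ r.2
  have hTF : ∀ r, ∀ p ∈ T r, p.1 ∈ F ∧ ‖p.1‖ ≤ r.2.2.2 ∧ |p.2| ≤ r.2.2.2 := by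
    rintro ⟨b, q⟩ p hp
    cases b
    · exact ⟨hp.1, hp.2.1, hp.2.2.1⟩
    · exact ⟨hp.1, hp.2.1, hp.2.2.1⟩
  have hT : ∀ r, ∀ p ∈ T r, ‖p.1‖ ≤ r.2.2.2 ∧ |p.2| ≤ r.2.2.2 := fun r p hp => (hTF r p hp).2
  refine exists_LUR_seminorm_of_family N hN hnormlsc (fun r => supAffine (T r))
    (fun r => supAffine_nonneg _) (fun r => convexOn_supAffine (hT r))
    (fun r => ⟨r.2.2.2, by positivity, supAffine_lipschitz (by positivity) (hT r)⟩)
    (fun r => lscAlong_supAffine hF (hT r) fun p hp => (hTF r p hp).1) fun x y hy hm => ?_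
  rw [Metric.tendsto_atTop]
  intro ε hε
  obtain ⟨i, hi⟩ := exists_nat_gt (5 / ε)
  obtain ⟨l, hl⟩ := exists_nat_ge ‖x‖
  obtain ⟨n, hn⟩ := Set.mem_iUnion.1 (hA (i, l) (Set.mem_univ x))
  obtain ⟨h₀, c₀, hh₀, h1, h2, h3⟩ := (hA' (i, l) n).2 x hn
  have hxD : x ∈ D (i, l) n := ⟨hn, hl⟩
  obtain ⟨j₁, hj₁⟩ := exists_nat_ge ‖h₀‖
  obtain ⟨j₂, hj₂⟩ := exists_nat_ge |c₀|
  set j := j₁ + j₂ with hj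
  set η : ℝ := 1 / (((i : ℝ) + 2) * ((l : ℝ) + 1)) with hηdef
  have hη0 : 0 < η := (hη (i, l)).1
  have hη2 : η ≤ 1 / 2 := (hη (i, l)).2
  set J : ℕ := 2 + l + 2 * l * (1 + j) with hJ
  set φ := supAffine (T (true, (i, l), n, j)) with hφ
  set d := supAffine (T (false, (i, l), n, J)) with hd
  have hmem₀ : (h₀, c₀) ∈ T (true, (i, l), n, j) := by
    refine ⟨hh₀, hj₁.trans ?_, hj₂.trans ?_, fun y hy => h2 y hy.1,
      fun y hy z hz => h3 y hy.1 z hz.1⟩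
    · rw [hj]; push_cast; linarith [Nat.cast_nonneg (α := ℝ) j₂]
    · rw [hj]; push_cast; linarith [Nat.cast_nonneg (α := ℝ) j₁]
  have hφx : 1 - η < φ x := h1.trans_le (le_supAffine (hT _) hmem₀ x)
  have hdx : d x = 0 := le_antisymm
    (supAffine_le le_rfl fun p hp => sub_nonpos.2 (hp.2.2.2 x hxD)) (supAffine_nonneg _ _)
  have hi1 : (0 : ℝ) < 1 / ((i : ℝ) + 1) := by positivity
  have e1 : ∀ᶠ n in atTop, φ (y n) < φ x + η / 4 :=
    (hy (true, (i, l), n, j)).eventually (gt_mem_nhds (by linarith))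
  have e2 : ∀ᶠ n in atTop, φ x - η / 4 < φ ((1 / 2 : ℝ) • (x + y n)) :=
    (hm (true, (i, l), n, j)).eventually (lt_mem_nhds (by linarith))
  have e3 : ∀ᶠ n in atTop, d (y n) < 1 / ((i : ℝ) + 1) := by
    refine (hy (false, (i, l), n, J)).eventually (gt_mem_nhds ?_)
    change d x < _
    rw [hdx]
    exact hi1
  refine eventually_atTop.1 ?_
  filter_upwards [e1, e2, e3] with k k1 k2 k3
  have hlt : (0 : ℝ) ≤ φ x - η / 4 := by linarith
  -- A slice almost optimal at the midpoint is almost optimal at both endpoints, as neither endpoint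
  -- value can much exceed `φ x`. So one slice has both `x` and `y k` near its top.
  obtain ⟨⟨h, c⟩, hp, hpm⟩ := exists_lt_of_lt_supAffine hlt k2
  have hpx := le_supAffine (hT _) hp x
  have hpy := le_supAffine (hT _) hp (y k)
  obtain ⟨hhF, hhj, hcj, hh1, hhd⟩ := hp
  simp only at hpm hpx hpy hhF hhj hcj hh1 hhd
  simp only [map_smul, map_add, smul_eq_mul] at hpm
  change h x - c ≤ φ x at hpx
  change h (y k) - c ≤ φ (y k) at hpy
  have hxc : c < h x := by linarith
  have hyc : 1 - 3 / 2 * η ≤ h (y k) - c := by linarith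
  set K : ℝ := 2 * l with hK
  have hl0 := Nat.cast_nonneg (α := ℝ) l
  have hK0 : 0 ≤ K := by positivity
  have hbound : ‖y k - x‖ ≤ 1 / ((i : ℝ) + 1) + K * (3 / 2 * η) + 1 / ((i : ℝ) + 1) := by
    refine hnorming _ _ (by positivity) fun g hg hg1 => ?_
    have hgle : ∀ z : E, |g z| ≤ ‖z‖ := fun z =>
      (g.le_opNorm z).trans (mul_le_of_le_one_left (norm_nonneg z) hg1)
    -- On the piece this affine function is nonpositive: inside the slice `g` varies by at most
    -- 1/(i+1) and `h ≤ 1 + c`; outside it, `g` gains at most `K = 2 * l` while `K • h` loses at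
    -- least `K`. At `y k` it is at most `d (y k)`, which bounds `g (y k - x)`.
    have hmem : (g + K • h, g x + K * (1 + c) + 1 / ((i : ℝ) + 1)) ∈
        T (false, (i, l), n, J) := by
      have hi1' : 1 / ((i : ℝ) + 1) ≤ 1 := by
        rw [div_le_one (by positivity)]
        linarith [Nat.cast_nonneg (α := ℝ) i]
      have hJ' : (J : ℝ) = 2 + l + K * (1 + j) := by rw [hJ, hK]; push_cast; ring
      refine ⟨F.add_mem hg (F.smul_mem _ hhF), ?_, ?_, fun z hz => ?_⟩
      · have : ‖g + K • h‖ ≤ 1 + K * j := by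
          refine (norm_add_le _ _).trans (add_le_add hg1 ?_)
          rw [norm_smul, Real.norm_eq_abs, abs_of_nonneg hK0]
          gcongr
        refine this.trans ?_
        simp only [hJ']
        linarith
      · have a1 := abs_le.1 (hgle x)
        have a2 := abs_le.1 hcj
        have a3 := mul_le_mul_of_nonneg_left a2.1 hK0
        have a4 := mul_le_mul_of_nonneg_left a2.2 hK0
        simp only [hJ']
        rw [abs_le]
        constructor <;> linarith
      · have hzl : ‖z‖ ≤ l := hz.2
        simp only [add_apply, smul_apply, smul_eq_mul]
        rcases lt_or_ge c (h z) with hcz | hcz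
        · have b1 := hhd z hz x hxD hcz hxc
          have b2 := (le_abs_self _).trans (hgle (z - x))
          have b3 := mul_le_mul_of_nonneg_left (hh1 z hz) hK0
          rw [map_sub] at b2
          linarith
        · have b1 := (abs_le.1 (hgle x)).1
          have b2 := (abs_le.1 (hgle z)).2
          have b3 := mul_le_mul_of_nonneg_left hcz hK0
          linarith
    have h4 := le_supAffine (hT _) hmem (y k)
    simp only [add_apply, smul_apply, smul_eq_mul] at h4
    change _ ≤ d (y k) at h4
    have h5 := mul_le_mul_of_nonneg_left hyc hK0
    rw [map_sub]
    linarith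
  rw [dist_eq_norm]
  have hKη : K * (3 / 2 * η) ≤ 3 * (1 / ((i : ℝ) + 1)) := by
    have i0 := Nat.cast_nonneg (α := ℝ) i
    have : K * (3 / 2 * η) = 3 * (l / (((i : ℝ) + 2) * ((l : ℝ) + 1))) := by
      rw [hK, hηdef]; ring
    rw [this]
    gcongr 3 * ?_
    rw [div_le_div_iff₀ (by positivity) (by positivity)]
    nlinarith
  have hfin : 5 * (1 / ((i : ℝ) + 1)) < ε := by
    rw [mul_one_div, div_lt_iff₀ (by positivity)]
    rw [div_lt_iff₀ hε] at hi
    nlinarith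
  linarith

end SupAffine

/-! ### Cantor–Bendixson derivatives and rank functions. -/

section CantorBendixson

open Ordinal

variable {Γ : Type*} [TopologicalSpace Γ]

/-- The transfinite Cantor–Bendixson derivatives of a set `Y`. -/
def cbDeriv (Y : Set Γ) (α : Ordinal.{0}) : Set Γ :=
  {z ∈ Y | ∀ β, ∀ _ : β < α, z ∈ closure (cbDeriv Y β \ {z})}
termination_by α

theorem mem_cbDeriv {Y : Set Γ} {α : Ordinal.{0}} {z : Γ} :
    z ∈ cbDeriv Y α ↔ z ∈ Y ∧ ∀ β < α, z ∈ closure (cbDeriv Y β \ {z}) := by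
  rw [cbDeriv]
  rfl

theorem cbDeriv_antitone (Y : Set Γ) : Antitone (cbDeriv Y) := by
  intro α β hαβ z hz
  rw [mem_cbDeriv] at hz ⊢
  exact ⟨hz.1, fun γ hγ => hz.2 γ (hγ.trans_le hαβ)⟩

theorem cbDeriv_subset (Y : Set Γ) (α : Ordinal.{0}) : cbDeriv Y α ⊆ Y :=
  fun _ hz => (mem_cbDeriv.1 hz).1

theorem countable_Iio_of_lt_omega_one {α : Ordinal.{0}} (h : α < ω₁) : Countable (Set.Iio α) := by
  rw [← Cardinal.mk_le_aleph0_iff, Cardinal.mk_Iio_ordinal, Cardinal.lift_le_aleph0]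
  rw [← Cardinal.ord_aleph, Cardinal.lt_ord, ← Cardinal.succ_aleph0] at h
  exact Order.lt_succ_iff.1 h

/-- A pigeonhole principle from the regularity of ω₁: if each index failed somewhere, the supremum
of the countably many failures would still be countable, and all indices would fail there. -/
theorem exists_forall_lt_omega_one {ι : Type*} [Countable ι] (P : ι → Ordinal.{0} → Prop)
    (hP : ∀ i α β, α ≤ β → P i β → P i α) (h : ∀ α < ω₁, ∃ i, P i α) :
    ∃ i, ∀ α < ω₁, P i α := by
  by_contra hcon
  push Not at hcon
  choose a ha hPa using hcon
  have hsup : ⨆ i, a i < ω₁ := Ordinal.iSup_lt_omega_one ha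
  obtain ⟨i, hi⟩ := h _ hsup
  refine hPa i (hP i _ _ ?_ hi)
  exact le_ciSup (Ordinal.bddAbove_of_small) i

/-- A set with vanishing derivative carries an upper semicontinuous rank function that has strict
local maxima at the points of the set. -/
theorem exists_rank_of_cbDeriv_eq_empty [T1Space Γ] {Y : Set Γ} {α : Ordinal.{0}}
    (h : cbDeriv Y α = ∅) : ∃ r : Γ → Set.Iio (Order.succ α), ∀ γ, ∃ U ∈ 𝓝 γ, ∀ γ' ∈ U,
      r γ' ≤ r γ ∧ (γ ∈ Y → γ' ≠ γ → r γ' < r γ) := by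
  have hex : ∀ γ, {β | γ ∉ closure (cbDeriv Y β)}.Nonempty := fun γ => ⟨α, by simp [h]⟩
  -- The closure makes the rank upper semicontinuous. A point of `Y` is isolated from some earlier
  -- derivative, which gives all its neighbours a strictly smaller rank.
  let r : Γ → Ordinal.{0} := fun γ => sInf {β | γ ∉ closure (cbDeriv Y β)}
  have hr : ∀ γ, γ ∉ closure (cbDeriv Y (r γ)) := fun γ => csInf_mem (hex γ)
  have hrle : ∀ {γ β}, γ ∉ closure (cbDeriv Y β) → r γ ≤ β := fun hβ => csInf_le' hβ
  have hrα : ∀ γ, r γ < Order.succ α := fun γ => Order.lt_succ_iff.2 (hrle (by simp [h]))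
  refine ⟨fun γ => ⟨r γ, hrα γ⟩, fun γ => ?_⟩
  have h1 : (closure (cbDeriv Y (r γ)))ᶜ ∈ 𝓝 γ := isClosed_closure.isOpen_compl.mem_nhds (hr γ)
  by_cases hγ : γ ∈ Y
  · have h2 : γ ∉ cbDeriv Y (r γ) := fun hmem => hr γ (subset_closure hmem)
    rw [mem_cbDeriv] at h2
    push Not at h2
    obtain ⟨β, hβ, hβ'⟩ := h2 hγ
    refine ⟨_, inter_mem h1 (isClosed_closure.isOpen_compl.mem_nhds hβ'), fun γ' hγ' => ?_⟩
    refine ⟨hrle hγ'.1, fun _ hne => ?_⟩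
    refine lt_of_le_of_lt (b := (⟨β, hβ.trans (hrα γ)⟩ : Set.Iio (Order.succ α))) ?_ hβ
    refine hrle fun hcl => ?_
    have h3 : (closure (cbDeriv Y β \ {γ}))ᶜ ∩ {γ}ᶜ ∈ 𝓝 γ' :=
      inter_mem (isClosed_closure.isOpen_compl.mem_nhds hγ'.2)
        (isOpen_compl_singleton.mem_nhds hne)
    obtain ⟨z, hz, hzY⟩ := mem_closure_iff_nhds.1 hcl _ h3
    exact hz.1 (subset_closure ⟨hzY, hz.2⟩)
  · exact ⟨_, h1, fun γ' hγ' => ⟨hrle hγ', fun h => absurd h hγ⟩⟩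

end CantorBendixson

/-! ### A uniform countable bound on the ranks, by a Cantor scheme. -/

section UniformRank

open Ordinal TopologicalSpace

variable {Γ : Type*}

/-- `s` and `t` are members of `K` that agree on all the sets `Q n`. -/
def AgreeOn (K : Set (Γ → ℝ)) (Q : ℕ → Finset Γ) (s t : Γ → ℝ) : Prop :=
  s ∈ K ∧ t ∈ K ∧ ∀ n, ∀ q ∈ Q n, s q = t q

theorem exists_approx_pair {K : Set (Γ → ℝ)} {d : ℕ → Γ → ℝ} (hd : K ⊆ closure (Set.range d))
    {s t : Γ → ℝ} (hs : s ∈ K) (ht : t ∈ K) {O : Set ((Γ → ℝ) × (Γ → ℝ))} (hO : IsOpen O)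
    (hst : (s, t) ∈ O) : ∃ k k', (d k, d k') ∈ O := by
  have h : (s, t) ∈ closure (Set.range d ×ˢ Set.range d) := by
    rw [closure_prod_eq]
    exact ⟨hd hs, hd ht⟩
  obtain ⟨⟨_, _⟩, hp, ⟨k, rfl⟩, ⟨k', rfl⟩⟩ := mem_closure_iff.1 h O hO hst
  exact ⟨k, k', hp⟩

/-- One refinement step in the construction of a Cantor scheme. -/
theorem exists_scheme_refinement [MetricSpace Γ] [SecondCountableTopology Γ] {K : Set (Γ → ℝ)}
    {d : ℕ → Γ → ℝ} (hdc : ∀ k, Continuous (d k)) (hd : K ⊆ closure (Set.range d))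
    (Q : ℕ → Finset Γ) {δ : ℝ} (n : ℕ) (u : List.Vector Bool n → countableBasis Γ)
    (hu : ∀ α < ω₁, ∃ s t, AgreeOn K Q s t ∧
      ∀ l, (cbDeriv {γ | δ < |s γ - t γ|} α ∩ (u l : Set Γ)).Nonempty) :
    ∃ u' : List.Vector Bool (n + 1) → countableBasis Γ,
      (∀ α < ω₁, ∃ s t, AgreeOn K Q s t ∧
        ∀ l, (cbDeriv {γ | δ < |s γ - t γ|} α ∩ (u' l : Set Γ)).Nonempty) ∧
      (∀ v, closure (u' v : Set Γ) ⊆ u v.tail) ∧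
      (∀ l, Disjoint (u' (true ::ᵥ l) : Set Γ) (u' (false ::ᵥ l) : Set Γ)) ∧
      (∀ v, Metric.ediam (u' v : Set Γ) ≤ ENNReal.ofReal (1 / ((n : ℝ) + 1))) ∧
      ∃ k k', (∀ v, ∀ γ ∈ (u' v : Set Γ), δ < |d k γ - d k' γ|) ∧
        ∀ q ∈ Q n, |d k q - d k' q| < 1 / ((n : ℝ) + 1) := by
  let good : (List.Vector Bool (n + 1) → countableBasis Γ) → Prop := fun u' =>
      (∀ v, closure (u' v : Set Γ) ⊆ u v.tail) ∧
      (∀ l, Disjoint (u' (true ::ᵥ l) : Set Γ) (u' (false ::ᵥ l) : Set Γ)) ∧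
      (∀ v, Metric.ediam (u' v : Set Γ) ≤ ENNReal.ofReal (1 / ((n : ℝ) + 1))) ∧
      ∃ k k', (∀ v, ∀ γ ∈ (u' v : Set Γ), δ < |d k γ - d k' γ|) ∧
        ∀ q ∈ Q n, |d k q - d k' q| < 1 / ((n : ℝ) + 1)
  -- There are only countably many candidates `u'`, so the refinement may be chosen separately for
  -- each `α`; one choice then serves all of them.
  suffices hα : ∀ α < ω₁, ∃ u' : {u' // good u'}, ∃ s t, AgreeOn K Q s t ∧
      ∀ l, (cbDeriv {γ | δ < |s γ - t γ|} α ∩ (u'.1 l : Set Γ)).Nonempty by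
    obtain ⟨⟨u', hu'⟩, h⟩ := exists_forall_lt_omega_one _ (fun u' α β hαβ ⟨s, t, hst, h⟩ =>
      ⟨s, t, hst, fun l => (h l).mono
        (Set.inter_subset_inter_left _ (cbDeriv_antitone _ hαβ))⟩) hα
    exact ⟨u', h, hu'⟩
  intro α hα
  -- A point of derivative `α + 1` is an accumulation point of derivative `α`, so spending one
  -- derivative gives two distinct points in every cell.
  obtain ⟨s, t, hst, h⟩ := hu (Order.succ α)
    (by
      rw [← Cardinal.ord_aleph] at hα ⊢
      exact (Cardinal.isSuccLimit_ord (Cardinal.aleph0_le_aleph 1)).succ_lt hα)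
  set Y := {γ | δ < |s γ - t γ|} with hY
  have hpair : ∀ l, ∃ z z', z ∈ cbDeriv Y α ∩ (u l : Set Γ) ∧ z' ∈ cbDeriv Y α ∩ (u l : Set Γ) ∧
      z ≠ z' := by
    intro l
    obtain ⟨z, hz, hzu⟩ := h l
    have h1 := (mem_cbDeriv.1 hz).2 α (Order.lt_succ α)
    obtain ⟨z', hz', hzY, hne⟩ := mem_closure_iff.1 h1 _ (isOpen_of_mem_countableBasis (u l).2) hzu
    exact ⟨z, z', ⟨cbDeriv_antitone Y (Order.le_succ α) hz, hzu⟩, ⟨hzY, hz'⟩, fun h => hne h.symm⟩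
  choose z z' hz hz' hne using hpair
  let w : List.Vector Bool (n + 1) → Γ := fun v => if v.head then z v.tail else z' v.tail
  have hw : ∀ v, w v ∈ cbDeriv Y α ∩ (u v.tail : Set Γ) := by
    intro v
    simp only [w]
    split
    · exact hz _
    · exact hz' _
  have hO : IsOpen {p : (Γ → ℝ) × (Γ → ℝ) | (∀ v, δ < |p.1 (w v) - p.2 (w v)|) ∧
      ∀ q ∈ Q n, |p.1 q - p.2 q| < 1 / ((n : ℝ) + 1)} := by
    have hc : ∀ γ, Continuous fun p : (Γ → ℝ) × (Γ → ℝ) => |p.1 γ - p.2 γ| := fun γ => by fun_prop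
    rw [Set.ofPred_and]
    refine IsOpen.inter ?_ ?_
    · rw [Set.ofPred_forall]
      exact isOpen_iInter_of_finite fun v => isOpen_lt continuous_const (hc _)
    · have : {p : (Γ → ℝ) × (Γ → ℝ) | ∀ q ∈ Q n, |p.1 q - p.2 q| < 1 / ((n : ℝ) + 1)} =
          ⋂ q ∈ Q n, {p | |p.1 q - p.2 q| < 1 / ((n : ℝ) + 1)} := by ext; simp
      rw [this]
      exact isOpen_biInter_finset fun q _ => isOpen_lt (hc _) continuous_const
  -- Replacing `s`, `t` by continuous approximants spreads the inequality from the points `w v` to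
  -- neighbourhoods, at the cost of agreeing on `Q n` only approximately.
  obtain ⟨k, k', hk1, hk2⟩ := exists_approx_pair hd hst.1 hst.2.1 hO
    ⟨fun v => cbDeriv_subset Y α (hw v).1, fun q hq => by
      change |s q - t q| < _
      rw [hst.2.2 n q hq, _root_.sub_self, abs_zero]; positivity⟩
  let ρ : List.Vector Bool (n + 1) → ℝ := fun v =>
    min (1 / (2 * ((n : ℝ) + 1))) (dist (z v.tail) (z' v.tail) / 2)
  have hρ : ∀ v, 0 < ρ v := fun v =>
    lt_min (by positivity) (half_pos (dist_pos.2 (hne v.tail)))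
  have hbasis : ∀ v, ∃ W ∈ countableBasis Γ, w v ∈ W ∧ closure W ⊆
      (u v.tail : Set Γ) ∩ Metric.ball (w v) (ρ v) ∩ {γ | δ < |d k γ - d k' γ|} := by
    intro v
    refine (isBasis_countableBasis Γ).exists_closure_subset ?_
    refine inter_mem (inter_mem ((isOpen_of_mem_countableBasis (u v.tail).2).mem_nhds (hw v).2)
      (Metric.ball_mem_nhds _ (hρ v))) ?_
    exact (isOpen_lt continuous_const (((hdc k).sub (hdc k')).abs)).mem_nhds (hk1 v)
  choose W hWb hwW hW using hbasis
  have hWball : ∀ v, W v ⊆ Metric.ball (w v) (ρ v) := fun v γ hγ => (hW v (subset_closure hγ)).1.2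
  refine ⟨⟨fun v => ⟨W v, hWb v⟩, fun v γ hγ => (hW v hγ).1.1, fun l => ?_, fun v => ?_, k, k',
    fun v γ hγ => (hW v (subset_closure hγ)).2, hk2⟩, s, t, hst,
    fun v => ⟨w v, (hw v).1, hwW v⟩⟩
  · refine Disjoint.mono (hWball _) (hWball _) (Metric.ball_disjoint_ball ?_)
    have h1 : ρ (true ::ᵥ l) ≤ dist (z l) (z' l) / 2 := min_le_right _ _
    have h2 : ρ (false ::ᵥ l) ≤ dist (z l) (z' l) / 2 := min_le_right _ _
    have h3 : w (true ::ᵥ l) = z l := by simp [w]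
    have h4 : w (false ::ᵥ l) = z' l := by simp [w]
    rw [h3, h4]
    linarith
  · refine Metric.ediam_le fun a ha b hb => ?_
    rw [edist_dist]
    refine ENNReal.ofReal_le_ofReal ?_
    have h1 := Metric.mem_ball.1 (hWball v ha)
    have h2 := Metric.mem_ball'.1 (hWball v hb)
    have h3 : ρ v ≤ 1 / (2 * ((n : ℝ) + 1)) := min_le_left _ _
    have h4 : 1 / (2 * ((n : ℝ) + 1)) + 1 / (2 * ((n : ℝ) + 1)) = 1 / ((n : ℝ) + 1) := by
      field_simp; norm_num
    linarith [dist_triangle a (w v) b]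

/-- If all members of `K` have countably many discontinuities, the sets `{δ < |s - t|}`, for
`s, t ∈ K` that agree on a dense set, have Cantor–Bendixson ranks bounded by a countable ordinal. -/
theorem exists_cbDeriv_eq_empty [TopologicalSpace Γ] [PolishSpace Γ] {K : Set (Γ → ℝ)}
    (hK : IsCompact K) {d : ℕ → Γ → ℝ} (hdK : ∀ k, d k ∈ K) (hdc : ∀ k, Continuous (d k))
    (hd : K ⊆ closure (Set.range d)) {Q : ℕ → Finset Γ} (hQm : Monotone Q)
    (hQ : Dense (⋃ n, (Q n : Set Γ))) (hdisc : ∀ s ∈ K, {γ : Γ | ¬ ContinuousAt s γ}.Countable)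
    {δ : ℝ} (hδ : 0 < δ) :
    ∃ α < ω₁, ∀ s t, AgreeOn K Q s t → cbDeriv {γ | δ < |s γ - t γ|} α = ∅ := by
  let _ := upgradeIsCompletelyMetrizable Γ
  by_contra hcon
  push Not at hcon
  let Good : ∀ n, (List.Vector Bool n → countableBasis Γ) → Prop := fun n u =>
    ∀ α < ω₁, ∃ s t, AgreeOn K Q s t ∧
      ∀ l, (cbDeriv {γ | δ < |s γ - t γ|} α ∩ (u l : Set Γ)).Nonempty
  obtain ⟨u₀, hu₀⟩ : ∃ u₀, Good 0 u₀ := by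
    refine exists_forall_lt_omega_one _ (fun u α β hαβ ⟨s, t, hst, h⟩ =>
      ⟨s, t, hst, fun l => (h l).mono
        (Set.inter_subset_inter_left _ (cbDeriv_antitone _ hαβ))⟩) fun α hα => ?_
    obtain ⟨s, t, hst, z, hz⟩ := hcon α hα
    obtain ⟨W, hW, hzW, -⟩ :=
      (isBasis_countableBasis Γ).exists_subset_of_mem_open (Set.mem_univ z) isOpen_univ
    exact ⟨fun _ => ⟨W, hW⟩, s, t, hst, fun _ => ⟨z, hz, hzW⟩⟩
  choose next hnext using fun n (u : List.Vector Bool n → countableBasis Γ) (hu : Good n u) =>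
    exists_scheme_refinement hdc hd Q n u hu
  let v : ∀ n, {u : List.Vector Bool n → countableBasis Γ // Good n u} := fun n =>
    Nat.rec ⟨u₀, hu₀⟩ (fun n p => ⟨next n p.1 p.2, (hnext n p.1 p.2).1⟩) n
  have hv : ∀ n, (v (n + 1)).1 = next n (v n).1 (v n).2 := fun n => rfl
  have hprop := fun n => (hnext n (v n).1 (v n).2).2
  simp only [← hv] at hprop
  let A : List Bool → Set Γ := fun l => ((v l.length).1 ⟨l, rfl⟩ : Set Γ)
  have hAv : ∀ n (l : List.Vector Bool n), A l.1 = ((v n).1 l : Set Γ) := by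
    rintro _ ⟨l, rfl⟩
    rfl
  have hanti : CantorScheme.ClosureAntitone A := fun l a => (hprop l.length).1 ⟨a :: l, rfl⟩
  have hdisj : CantorScheme.Disjoint A := by
    intro l a b hab
    have h := (hprop l.length).2.1 ⟨l, rfl⟩
    cases a <;> cases b
    · exact absurd rfl hab
    · exact h.symm
    · exact h
    · exact absurd rfl hab
  have hdiam : CantorScheme.VanishingDiam A := by
    intro x
    have h1 : Tendsto (fun n : ℕ => ENNReal.ofReal (1 / ((n : ℝ) + 1))) atTop (𝓝 0) := by
      have := ENNReal.tendsto_ofReal (tendsto_one_div_add_atTop_nhds_zero_nat (𝕜 := ℝ))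
      rwa [ENNReal.ofReal_zero] at this
    rw [← tendsto_add_atTop_iff_nat 1]
    refine tendsto_of_tendsto_of_tendsto_of_le_of_le tendsto_const_nhds h1 (fun _ => zero_le)
      fun n => ?_
    exact (congrArg Metric.ediam (hAv (n + 1) ⟨PiNat.res x (n + 1),
      PiNat.res_length x (n + 1)⟩)).trans_le ((hprop n).2.2.1 _)
  have hne : ∀ l, (A l).Nonempty := by
    intro l
    obtain ⟨s, t, -, h⟩ := (v l.length).2 0 (Ordinal.omega_pos 1)
    exact (h ⟨l, rfl⟩).mono Set.inter_subset_right
  have hdom := hanti.map_of_vanishingDiam hdiam hne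
  have hinj := hdisj.map_injective
  let f : (ℕ → Bool) → Γ := fun x => (CantorScheme.inducedMap A).2 ⟨x, hdom ▸ Set.mem_univ x⟩
  have hf : Function.Injective f := fun x y hxy => congrArg Subtype.val (hinj hxy)
  have hfA : ∀ x n, f x ∈ A (PiNat.res x n) := fun x n => CantorScheme.map_mem _ n
  choose k k' hk1 hk2 using fun n => (hprop n).2.2.2
  -- A cluster pair of the approximants differs by at least `δ` along the whole Cantor set but
  -- agrees on the dense set, so `s` or `t` is discontinuous at each point of the Cantor set.
  obtain ⟨⟨s, t⟩, ⟨hs, ht⟩, hst⟩ := (hK.prod hK).exists_mapClusterPt (f := atTop)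
    (u := fun n => (d (k n), d (k' n)))
    (tendsto_principal.2 (Eventually.of_forall fun n => ⟨hdK _, hdK _⟩))
  have hcl : ∀ γ, MapClusterPt (|s γ - t γ|) atTop fun n => |d (k n) γ - d (k' n) γ| := by
    intro γ
    have hc : Continuous fun p : (Γ → ℝ) × (Γ → ℝ) => |p.1 γ - p.2 γ| := by fun_prop
    exact MapClusterPt.continuousAt_comp (f := fun p : (Γ → ℝ) × (Γ → ℝ) => |p.1 γ - p.2 γ|)
      hc.continuousAt hst
  have hclosed : ∀ γ (C : Set ℝ), IsClosed C →
      (∀ᶠ n in atTop, |d (k n) γ - d (k' n) γ| ∈ C) → |s γ - t γ| ∈ C := fun γ C hC h =>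
    isClosed_iff_clusterPt.1 hC _ ((hcl γ).clusterPt.mono (le_principal_iff.2 h))
  have hfst : ∀ x, δ ≤ |s (f x) - t (f x)| := by
    intro x
    refine hclosed (f x) (Set.Ici δ) isClosed_Ici (Eventually.of_forall fun n => ?_)
    exact (hk1 n _ (f x) ((hAv (n + 1) ⟨PiNat.res x (n + 1),
      PiNat.res_length x (n + 1)⟩).le (hfA x (n + 1)))).le
  have hQst : ∀ q ∈ ⋃ n, (Q n : Set Γ), |s q - t q| = 0 := by
    intro q hq
    obtain ⟨m, hm⟩ := Set.mem_iUnion.1 hq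
    refine le_antisymm ?_ (abs_nonneg _)
    refine le_of_forall_pos_le_add fun ε hε => ?_
    rw [zero_add]
    refine hclosed q (Set.Iic ε) isClosed_Iic ?_
    have h1 := (tendsto_one_div_add_atTop_nhds_zero_nat (𝕜 := ℝ)).eventually (gt_mem_nhds hε)
    filter_upwards [h1, eventually_ge_atTop m] with n hn hmn
    exact ((hk2 n q (hQm hmn hm)).trans hn).le
  have hsub : Set.range f ⊆ {γ | ¬ ContinuousAt s γ} ∪ {γ | ¬ ContinuousAt t γ} := by
    rintro _ ⟨x, rfl⟩
    by_contra hx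
    rw [Set.mem_union, not_or] at hx
    simp only [Set.mem_ofPred_eq, not_not] at hx
    have hc : ContinuousAt (fun γ => |s γ - t γ|) (f x) := (hx.1.sub hx.2).abs
    have h1 := hc.eventually (lt_mem_nhds (show δ / 2 < |s (f x) - t (f x)| by
      linarith [hfst x]))
    obtain ⟨q, hqQ, hq⟩ := hQ.inter_nhds_nonempty h1
    have h2 : δ / 2 < |s q - t q| := hq
    rw [hQst q hqQ] at h2
    linarith
  have hcount : (Set.range f).Countable := ((hdisc s hs).union (hdisc t ht)).mono hsub
  have huniv : (Set.univ : Set (ℕ → Bool)).Countable := by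
    have := hcount.preimage_of_injOn (f := f) hf.injOn
    rwa [Set.preimage_range] at this
  have := Cardinal.mk_le_aleph0_iff.2 (Set.countable_univ_iff.1 huniv)
  simp only [Cardinal.mk_pi, Cardinal.mk_fintype, Fintype.card_bool, Nat.cast_ofNat,
    Cardinal.prod_const, Cardinal.lift_id, Cardinal.mk_nat, Cardinal.two_power_aleph0] at this
  exact this.not_gt Cardinal.aleph0_lt_continuum

/-- A uniform family of ranks for the sets `{δ < |s - t|}`. -/
theorem exists_uniform_rank [TopologicalSpace Γ] [PolishSpace Γ] {K : Set (Γ → ℝ)}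
    (hK : IsCompact K) {d : ℕ → Γ → ℝ} (hdK : ∀ k, d k ∈ K) (hdc : ∀ k, Continuous (d k))
    (hd : K ⊆ closure (Set.range d)) {Q : ℕ → Finset Γ} (hQm : Monotone Q)
    (hQ : Dense (⋃ n, (Q n : Set Γ))) (hdisc : ∀ s ∈ K, {γ : Γ | ¬ ContinuousAt s γ}.Countable)
    {δ : ℝ} (hδ : 0 < δ) :
    ∃ (W : Type 1) (_ : LinearOrder W) (_ : WellFoundedLT W) (_ : Countable W),
      ∀ s t, AgreeOn K Q s t → ∃ r : Γ → W, ∀ γ, ∃ U ∈ 𝓝 γ, ∀ γ' ∈ U,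
        r γ' ≤ r γ ∧ (δ < |s γ - t γ| → γ' ≠ γ → r γ' < r γ) := by
  obtain ⟨α, hα, h⟩ := exists_cbDeriv_eq_empty hK hdK hdc hd hQm hQ hdisc hδ
  refine ⟨Set.Iio (Order.succ α), inferInstance, inferInstance, countable_Iio_of_lt_omega_one ?_,
    fun s t hst => exists_rank_of_cbDeriv_eq_empty (h s t hst)⟩
  rw [← Cardinal.ord_aleph] at hα ⊢
  exact (Cardinal.isSuccLimit_ord (Cardinal.aleph0_le_aleph 1)).succ_lt hα

end UniformRank

/-! ### Slicing C(K) through finitely many controlling coordinates. -/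

section Control

variable {Γ : Type*} {K : Set (Γ → ℝ)} [CompactSpace K]

/-- By compactness, a continuous function on `K` that is controlled by the coordinates in `Θ` is
controlled, up to a small error, by finitely many of them. -/
theorem exists_finite_control (x : C(K, ℝ)) (Θ : Set Γ) {ε ε' : ℝ} (hε : ε < ε')
    (h : ∀ s t : K, (∀ γ ∈ Θ, s.1 γ = t.1 γ) → |x s - x t| ≤ ε) :
    ∃ G : Finset Γ, (G : Set Γ) ⊆ Θ ∧ ∃ n : ℕ, ∀ s t : K,
      (∀ γ ∈ G, |s.1 γ - t.1 γ| < 1 / ((n : ℝ) + 1)) → |x s - x t| < ε' := by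
  classical
  have hC : IsCompact {p : K × K | ε' ≤ |x p.1 - x p.2|} :=
    (isClosed_le continuous_const (by fun_prop)).isCompact
  have hcoord : ∀ γ : Γ, Continuous fun p : K × K => |p.1.1 γ - p.2.1 γ| := fun γ =>
    (((continuous_apply γ).comp (continuous_subtype_val.comp continuous_fst)).sub
      ((continuous_apply γ).comp (continuous_subtype_val.comp continuous_snd))).abs
  obtain ⟨u, hu⟩ := hC.elim_finite_subfamily_closed
    (fun q : Θ × ℕ => {p : K × K | |p.1.1 q.1 - p.2.1 q.1| ≤ 1 / ((q.2 : ℝ) + 1)})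
    (fun q => isClosed_le (hcoord _) continuous_const) (by
      refine Set.eq_empty_of_forall_notMem fun p hp => ?_
      have h1 : ε' ≤ |x p.1 - x p.2| := hp.1
      have h2 := h p.1 p.2 fun γ hγ => by
        have h3 : ∀ n : ℕ, |p.1.1 γ - p.2.1 γ| ≤ 1 / ((n : ℝ) + 1) := fun n =>
          Set.mem_iInter.1 hp.2 (⟨γ, hγ⟩, n)
        have h4 := ge_of_tendsto' (tendsto_one_div_add_atTop_nhds_zero_nat (𝕜 := ℝ)) h3
        exact sub_eq_zero.1 (abs_eq_zero.1 (le_antisymm h4 (abs_nonneg _)))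
      linarith)
  refine ⟨u.image fun q => q.1.1, ?_, u.sup fun q => q.2, fun s t hst => ?_⟩
  · intro γ hγ
    obtain ⟨q, -, rfl⟩ := Finset.mem_image.1 (Finset.mem_coe.1 hγ)
    exact q.1.2
  · by_contra hlt
    rw [not_lt] at hlt
    refine Set.notMem_empty (s, t) (hu ▸ ⟨hlt, ?_⟩)
    refine Set.mem_iInter₂.2 fun q hq => ?_
    have h1 := hst q.1.1 (Finset.mem_image_of_mem _ hq)
    have h2 : q.2 ≤ u.sup fun q => q.2 := Finset.le_sup (f := fun q : Θ × ℕ => q.2) hq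
    refine (h1.trans_le ?_).le
    exact one_div_le_one_div_of_le (by positivity) (by gcongr)

/-- `s` and `t` agree on all the sets `Q n`. -/
def Agree (Q : ℕ → Finset Γ) (s t : K) : Prop :=
  ∀ n, ∀ q ∈ Q n, s.1 q = t.1 q

variable {F : Submodule ℝ (C(K, ℝ) →L[ℝ] ℝ)}

/-- If the labels `M x i`, `i ∈ I x`, can be sliced, and control `x` together with a countable set,
then there are slices of small diameter. -/
theorem sliceCover_norm_of_label {Q : ℕ → Finset Γ} (hQm : Monotone Q) {d : ℕ → K}
    (hd : DenseRange d) {m : ℕ} {X : Set C(K, ℝ)} (M : C(K, ℝ) → Fin m → Γ)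
    (I : C(K, ℝ) → Finset (Fin m)) {ε : ℝ} (hε : 0 < ε)
    (hcov : SliceCover F X fun y z => I y = I z ∧ ∀ i ∈ I y, M y i = M z i)
    (hI : ∀ x ∈ X, ∀ s t : K, Agree Q s t → (∀ i ∈ I x, s.1 (M x i) = t.1 (M x i)) →
      |x s - x t| ≤ ε) :
    SliceCover F X fun y z => ‖y - z‖ ≤ 5 * ε := by
  classical
  have hctrl : ∀ x : C(K, ℝ), ∃ n : ℕ, x ∈ X → ∀ s t : K,
      (∀ q ∈ Q n, |s.1 q - t.1 q| < 1 / ((n : ℝ) + 1)) →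
      (∀ i ∈ I x, |s.1 (M x i) - t.1 (M x i)| < 1 / ((n : ℝ) + 1)) → |x s - x t| < 2 * ε := by
    intro x
    by_cases hx : x ∈ X
    swap
    · exact ⟨0, fun h => absurd h hx⟩
    obtain ⟨G, hG, n, hn⟩ := exists_finite_control x
      ((⋃ n, (Q n : Set Γ)) ∪ {γ | ∃ i ∈ I x, M x i = γ}) (show ε < 2 * ε by linarith)
      fun s t hst => hI x hx s t (fun n q hq => hst q (Or.inl (Set.mem_iUnion.2 ⟨n, hq⟩)))
        fun i hi => hst _ (Or.inr ⟨i, hi, rfl⟩)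
    have hfin : ∃ k, ∀ γ ∈ G, γ ∈ Q k ∨ ∃ i ∈ I x, M x i = γ := by
      have : ∀ γ : Γ, ∃ k, γ ∈ G → (γ ∈ Q k ∨ ∃ i ∈ I x, M x i = γ) := by
        intro γ
        by_cases hγ : γ ∈ G
        · rcases hG hγ with h | h
          · obtain ⟨k, hk⟩ := Set.mem_iUnion.1 h
            exact ⟨k, fun _ => Or.inl hk⟩
          · exact ⟨0, fun _ => Or.inr h⟩
        · exact ⟨0, fun h => absurd h hγ⟩
      choose k hk using this
      exact ⟨G.sup k, fun γ hγ => (hk γ hγ).imp_left fun h => hQm (Finset.le_sup hγ) h⟩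
    obtain ⟨k, hk⟩ := hfin
    refine ⟨max n k, fun _ s t h1 h2 => hn s t fun γ hγ => ?_⟩
    have hle : 1 / (((max n k : ℕ) : ℝ) + 1) ≤ 1 / ((n : ℝ) + 1) :=
      one_div_le_one_div_of_le (by positivity) (by gcongr; exact le_max_left n k)
    rcases hk γ hγ with h | ⟨i, hi, rfl⟩
    · exact (h1 γ (hQm (le_max_right n k) h)).trans_le hle
    · exact (h2 i hi).trans_le hle
  choose N hN using hctrl
  have hnet : ∀ x : C(K, ℝ), ∃ T : Finset ℕ, ∀ s : K, ∃ k ∈ T,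
      (∀ q ∈ Q (N x), |s.1 q - (d k).1 q| < 1 / ((N x : ℝ) + 1)) ∧
      ∀ i ∈ I x, |s.1 (M x i) - (d k).1 (M x i)| < 1 / ((N x : ℝ) + 1) := by
    intro x
    set η : ℝ := 1 / ((N x : ℝ) + 1) with hη
    have hη0 : 0 < η := by positivity
    set G : Finset Γ := Q (N x) ∪ (I x).image (M x) with hG
    have hcoord : ∀ γ : Γ, Continuous fun s : K => s.1 γ := fun γ =>
      (continuous_apply γ).comp continuous_subtype_val
    have hopen : ∀ t : K, IsOpen {s : K | ∀ γ ∈ G, |s.1 γ - t.1 γ| < η} := by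
      intro t
      have : {s : K | ∀ γ ∈ G, |s.1 γ - t.1 γ| < η} = ⋂ γ ∈ G, {s : K | |s.1 γ - t.1 γ| < η} := by
        ext; simp
      rw [this]
      exact isOpen_biInter_finset fun γ _ =>
        isOpen_lt (((hcoord γ).sub continuous_const).abs) continuous_const
    obtain ⟨T, hT⟩ := isCompact_univ.elim_finite_subcover
      (fun k : ℕ => {s : K | ∀ γ ∈ G, |s.1 γ - (d k).1 γ| < η}) (fun k => hopen (d k)) (by
        intro s _
        obtain ⟨_, hk, ⟨k, rfl⟩⟩ := hd.inter_open_nonempty _ (hopen s) ⟨s, by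
          intro γ _
          rw [sub_self, abs_zero]
          exact hη0⟩
        refine Set.mem_iUnion.2 ⟨k, fun γ hγ => ?_⟩
        rw [abs_sub_comm]
        exact hk γ hγ)
    refine ⟨T, fun s => ?_⟩
    obtain ⟨k, hk, hs⟩ := Set.mem_iUnion₂.1 (hT (Set.mem_univ s))
    exact ⟨k, hk, fun q hq => hs q (Finset.mem_union_left _ hq),
      fun i hi => hs _ (Finset.mem_union_right _ (Finset.mem_image_of_mem _ hi))⟩
  choose T hT using hnet
  -- The code stores the modulus `N x` and the values of `x`, rounded to multiples of `ε`, on a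
  -- finite net from the dense sequence. For equal codes and labels the errors are 2ε + ε + 2ε.
  let code : C(K, ℝ) → ℕ × Finset (ℕ × ℤ) := fun x =>
    (N x, (T x).image fun k => (k, ⌊x (d k) / ε⌋))
  -- The zero functional with level -1 gives the whole piece as a slice: only the countable code is
  -- used.
  have hcomp := hcov.comp (S := fun y z => (I y = I z ∧ ∀ i ∈ I y, M y i = M z i) ∧
    code y = code z) code (fun x _ => ⟨0, F.zero_mem, -1, by simp,
      fun y _ hc hR _ => ⟨hR, hc.symm⟩⟩) (by
    rintro x y z ⟨⟨h1, h2⟩, h3⟩ ⟨⟨h4, h5⟩, h6⟩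
    refine ⟨⟨h1.symm.trans h4, fun i hi => ?_⟩, h3.symm.trans h6⟩
    have hi' : i ∈ I x := h1 ▸ hi
    exact (h2 i hi').symm.trans (h5 i hi'))
  refine hcomp.mono_inter fun y hy z hz hyz => ?_
  obtain ⟨⟨hIyz, hMyz⟩, hcode⟩ := hyz
  have hNyz : N y = N z := congrArg Prod.fst hcode
  have hTyz : (T y).image (fun k => (k, ⌊y (d k) / ε⌋)) =
      (T z).image (fun k => (k, ⌊z (d k) / ε⌋)) := congrArg Prod.snd hcode
  rw [ContinuousMap.norm_le _ (by positivity)]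
  intro s
  obtain ⟨k, hk, hk1, hk2⟩ := hT y s
  have hky := hN y hy s (d k) hk1 hk2
  have hkz := hN z hz s (d k) (by rw [← hNyz]; exact hk1) (by
    rw [← hNyz, ← hIyz]
    intro i hi
    rw [← hMyz i hi]
    exact hk2 i hi)
  have hmem : (k, ⌊y (d k) / ε⌋) ∈ (T z).image (fun k => (k, ⌊z (d k) / ε⌋)) := by
    rw [← hTyz]
    exact Finset.mem_image_of_mem _ hk
  obtain ⟨k', -, hk'⟩ := Finset.mem_image.1 hmem
  obtain ⟨rfl, hfl⟩ := Prod.mk.inj hk'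
  have h1 := Int.abs_sub_lt_one_of_floor_eq_floor hfl
  rw [← sub_div, abs_div, abs_of_pos hε, div_lt_one hε] at h1
  rw [ContinuousMap.sub_apply, Real.norm_eq_abs, abs_le]
  rw [abs_lt] at hky hkz h1
  constructor <;> linarith

/-- The key step: the part of a controlling tuple `M x` that is needed to control `x` together with a
countable dense set can be determined by slices. -/
theorem exists_sliceCover_label [TopologicalSpace Γ] [SecondCountableTopology Γ]
    (hF : ∀ s : K, ContinuousMap.evalCLM ℝ s ∈ F) {Q : ℕ → Finset Γ} {δ : ℝ} (hδ : 0 < δ)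
    {W : Type*} [LinearOrder W] [WellFoundedLT W] [Countable W]
    (hW : ∀ s t : K, Agree Q s t → ∃ r : Γ → W, ∀ γ, ∃ U ∈ 𝓝 γ, ∀ γ' ∈ U,
      r γ' ≤ r γ ∧ (δ < |s.1 γ - t.1 γ| → γ' ≠ γ → r γ' < r γ))
    {m : ℕ} {X : Set C(K, ℝ)} (M : C(K, ℝ) → Fin m → Γ) {ε : ℝ}
    (hM : ∀ x ∈ X, ∀ s t : K, (∀ i, |s.1 (M x i) - t.1 (M x i)| ≤ δ) → x s - x t ≤ ε) (p : ℕ) :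
    ∃ I : C(K, ℝ) → Finset (Fin m),
      SliceCover F X (fun y z => I y = I z ∧ ∀ i ∈ I y, M y i = M z i) ∧
      ∀ x ∈ X, p ≤ (I x).card ∨ ∀ s t : K, Agree Q s t →
        (∀ i ∈ I x, s.1 (M x i) = t.1 (M x i)) → x s - x t ≤ ε := by
  classical
  choose r hr using hW
  induction p with
  | zero =>
    refine ⟨fun _ => ∅, ⟨fun _ => X, fun x hx => Set.mem_iUnion.2 ⟨0, hx⟩, fun _ x _ =>
      ⟨0, F.zero_mem, -1, by simp, fun y _ z _ _ _ => ⟨rfl, by simp⟩⟩⟩, fun x _ => Or.inl (by simp)⟩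
  | succ p ih =>
    obtain ⟨I, hcov, hI⟩ := ih
    let Free : C(K, ℝ) → K → K → Prop := fun x s t =>
      (∀ i ∈ I x, s.1 (M x i) = t.1 (M x i)) ∧ ε < x s - x t
    have hdata : ∀ x : C(K, ℝ), ∃ (J : Finset (Fin m))
        (o : Option ((Fin m → W) × (Fin m → TopologicalSpace.countableBasis Γ))), x ∈ X →
        (J = I x ∧ o = none ∧ ∀ s t : K, Agree Q s t → ¬Free x s t) ∨
        ∃ v U s t, ∃ h : Agree Q s t, o = some (v, U) ∧ Free x s t ∧
          J = I x ∪ Finset.univ.filter (fun i => δ < |s.1 (M x i) - t.1 (M x i)|) ∧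
          (v = fun i => r s t h (M x i)) ∧ (∀ i, M x i ∈ (U i : Set Γ) ∧ ∀ γ' ∈ (U i : Set Γ),
            r s t h γ' ≤ r s t h (M x i) ∧ (δ < |s.1 (M x i) - t.1 (M x i)| → γ' ≠ M x i →
              r s t h γ' < r s t h (M x i))) ∧
          ∀ s' t' h', Free x s' t' → ¬ (fun i => r s' t' h' (M x i)) < v := by
      intro x
      by_cases hfree : ∃ s t, Agree Q s t ∧ Free x s t
      · let V : Set (Fin m → W) := {v | ∃ s t, ∃ h : Agree Q s t, Free x s t ∧
          v = fun i => r s t h (M x i)}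
        have hV : V.Nonempty := by
          obtain ⟨s, t, h, hf⟩ := hfree
          exact ⟨_, s, t, h, hf, rfl⟩
        -- Minimal for the product order on `Fin m → W`, which is well-founded because the index set
        -- is finite.
        obtain ⟨v, ⟨s, t, h, hf, hv⟩, hmin⟩ := wellFounded_lt.has_min V hV
        have hU : ∀ i, ∃ U : TopologicalSpace.countableBasis Γ, M x i ∈ (U : Set Γ) ∧
            ∀ γ' ∈ (U : Set Γ), r s t h γ' ≤ r s t h (M x i) ∧
              (δ < |s.1 (M x i) - t.1 (M x i)| → γ' ≠ M x i →
                r s t h γ' < r s t h (M x i)) := by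
          intro i
          obtain ⟨U, hU, hU'⟩ := hr s t h (M x i)
          obtain ⟨O, hO, hmO, hOU⟩ :=
            (TopologicalSpace.isBasis_countableBasis Γ).mem_nhds_iff.1 hU
          exact ⟨⟨O, hO⟩, hmO, fun γ' hγ' => hU' γ' (hOU hγ')⟩
        choose U hU using hU
        exact ⟨_, _, fun _ => Or.inr ⟨v, U, s, t, h, rfl, hf, rfl, hv, hU,
          fun s' t' h' hf' => hmin _ ⟨s', t', h', hf', rfl⟩⟩⟩
      · push Not at hfree
        exact ⟨I x, none, fun _ => Or.inl ⟨rfl, rfl, hfree⟩⟩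
    choose J o hJo using hdata
    refine ⟨J, hcov.comp (fun x => (J x, o x)) (fun x hx => ?_) ?_, fun x hx => ?_⟩
    · rcases hJo x hx with ⟨hJ, ho, -⟩ | ⟨v, U, s, t, h, ho, hf, hJ, hv, hU, -⟩
      · refine ⟨0, F.zero_mem, -1, by simp, fun y hy hcode hR _ => ?_⟩
        have hJy : J y = J x := congrArg Prod.fst hcode
        refine ⟨hJy.symm, fun i hi => hR.2 i (hJ ▸ hi)⟩
      · refine ⟨ContinuousMap.evalCLM ℝ s - ContinuousMap.evalCLM ℝ t, F.sub_mem (hF s) (hF t), ε,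
          by simpa using hf.2, fun y hy hcode hR hcy => ?_⟩
        have hcy' : ε < y s - y t := by simpa using hcy
        have hJy : J y = J x := congrArg Prod.fst hcode
        have hoy : o y = some (v, U) := (congrArg Prod.snd hcode).trans ho
        rcases hJo y hy with ⟨-, ho', -⟩ | ⟨v', U', s', t', h', ho', -, -, -, hU', hmin⟩
        · rw [hoy] at ho'
          exact absurd ho' (by simp)
        rw [hoy] at ho'
        obtain ⟨rfl, rfl⟩ := Prod.mk.inj (Option.some.inj ho')
        have hfy : Free y s t := by
          refine ⟨fun i hi => ?_, hcy'⟩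
          rw [← hR.1] at hi
          rw [← hR.2 i hi]
          exact hf.1 i hi
        -- Equal codes put `M y i` in the neighbourhood `U i` of `M x i`, so the ranks of `s`, `t`
        -- cannot increase; minimality of `v` for `y` then forces equality.
        have hle : (fun i => r s t h (M y i)) ≤ v := by
          intro i
          rw [hv]
          exact ((hU i).2 (M y i) (hU' i).1).1
        have heq : (fun i => r s t h (M y i)) = v := by
          by_contra hne
          exact hmin s t h hfy (lt_of_le_of_ne hle hne)
        refine ⟨hJy.symm, fun i hi => ?_⟩
        rw [hJ, Finset.mem_union, Finset.mem_filter] at hi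
        rcases hi with hi | ⟨-, hi⟩
        · exact hR.2 i hi
        · by_contra hne
          have h1 := ((hU i).2 (M y i) (hU' i).1).2 hi (Ne.symm hne)
          have h2 := congrFun (heq.trans hv) i
          exact h1.ne h2
    · rintro x y z ⟨h1, h2⟩ ⟨h4, h5⟩
      refine ⟨h1.symm.trans h4, fun i hi => ?_⟩
      have hi' : i ∈ J x := h1 ▸ hi
      exact (h2 i hi').symm.trans (h5 i hi')
    · rcases hJo x hx with ⟨hJ, -, hnf⟩ | ⟨v, U, s, t, h, -, hf, hJ, -⟩
      · right
        intro s t hst hi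
        by_contra hlt
        exact hnf s t hst ⟨hJ ▸ hi, not_le.1 hlt⟩
      · left
        have hp : p ≤ (I x).card := (hI x hx).resolve_right fun hc =>
          hf.2.not_ge (hc s t h hf.1)
        obtain ⟨i, hi⟩ : ∃ i, δ < |s.1 (M x i) - t.1 (M x i)| := by
          by_contra hcon
          push Not at hcon
          exact hf.2.not_ge (hM x hx s t hcon)
        have hiI : i ∉ I x := fun hmem => by
          rw [hf.1 i hmem, sub_self, abs_zero] at hi
          exact hi.not_gt hδ
        -- The pair differs by more than `δ` at some coordinate, whereas it agrees on those in `I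
        -- x`; so the round gains a coordinate.
        have hss : I x ⊂ J x := by
          rw [hJ]
          refine Finset.ssubset_iff_subset_ne.2 ⟨Finset.subset_union_left, fun heq => hiI ?_⟩
          rw [heq]
          exact Finset.mem_union_right _ (Finset.mem_filter.2 ⟨Finset.mem_univ i, hi⟩)
        exact hp.trans_lt (Finset.card_lt_card hss)

end Control

/-! ### Refinement of the topology of Γ and conclusion. -/

section Main

open TopologicalSpace

theorem exists_monotone_finset_dense (Γ : Type*) [TopologicalSpace Γ] [SeparableSpace Γ] :
    ∃ Q : ℕ → Finset Γ, Monotone Q ∧ Dense (⋃ n, (Q n : Set Γ)) := by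
  classical
  rcases isEmpty_or_nonempty Γ with h | h
  · exact ⟨fun _ => ∅, monotone_const, fun γ => isEmptyElim γ⟩
  · refine ⟨fun n => (Finset.range n).image (denseSeq Γ), fun a b hab =>
      Finset.image_subset_image (Finset.range_mono hab), (denseRange_denseSeq Γ).mono ?_⟩
    rintro _ ⟨n, rfl⟩
    exact Set.mem_iUnion.2 ⟨n + 1, Finset.mem_coe.2
      (Finset.mem_image_of_mem _ (Finset.self_mem_range_succ n))⟩

/-- Countably many points of a Polish space can be made isolated in a finer Polish topology. -/
theorem exists_polishSpace_isOpen_singleton {Γ : Type*} [t : TopologicalSpace Γ] [PolishSpace Γ]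
    {S : Set Γ} (hS : S.Countable) :
    ∃ t' : TopologicalSpace Γ, t' ≤ t ∧ @PolishSpace Γ t' ∧ ∀ γ ∈ S, IsOpen[t'] {γ} := by
  have : Countable S := hS.to_subtype
  choose m hm hmP _ hmO using fun γ : S => (isClosed_singleton (x := γ.1)).isClopenable
  obtain ⟨t', ht', htt', hP⟩ := PolishSpace.exists_polishSpace_forall_le m hm hmP
  exact ⟨t', htt', hP, fun γ hγ => ht' ⟨γ, hγ⟩ _ (hmO ⟨γ, hγ⟩)⟩

/-- A sequence of functions with countably many discontinuities on a Polish space becomes continuous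
in a finer Polish topology. -/
theorem exists_polishSpace_continuous {Γ : Type*} [t : TopologicalSpace Γ] [PolishSpace Γ]
    (f : ℕ → Γ → ℝ) (hf : ∀ k, {γ : Γ | ¬ ContinuousAt (f k) γ}.Countable) :
    ∃ t' : TopologicalSpace Γ, t' ≤ t ∧ @PolishSpace Γ t' ∧ (∀ k, Continuous[t', _] (f k)) ∧
      ∀ s : Γ → ℝ, {γ | ¬ @ContinuousAt Γ ℝ t' _ s γ} ⊆ {γ | ¬ @ContinuousAt Γ ℝ t _ s γ} := by
  -- Isolating all discontinuities of the sequence makes each `f k` continuous, and a finer topology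
  -- creates no new discontinuities.
  obtain ⟨t', ht', hP, hopen⟩ := exists_polishSpace_isOpen_singleton (Set.countable_iUnion hf)
  refine ⟨t', ht', hP, fun k => continuous_iff_continuousAt.2 fun γ => ?_,
    fun s γ h hc => h (Tendsto.mono_left hc (_root_.nhds_mono ht'))⟩
  by_cases h : @ContinuousAt Γ ℝ t _ (f k) γ
  · exact Tendsto.mono_left h (_root_.nhds_mono ht')
  · rw [ContinuousAt, isOpen_singleton_iff_nhds_eq_pure γ |>.1
      (hopen γ (Set.mem_iUnion.2 ⟨k, h⟩))]
    exact tendsto_pure_nhds _ _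

variable {Γ : Type*} {K : Set (Γ → ℝ)}

theorem sliceCover_norm [TopologicalSpace Γ] [PolishSpace Γ] [CompactSpace K] {d : ℕ → K}
    (hd : DenseRange d) (hdc : ∀ k, Continuous (d k).1)
    (hdisc : ∀ s ∈ K, {γ : Γ | ¬ ContinuousAt s γ}.Countable)
    {F : Submodule ℝ (C(K, ℝ) →L[ℝ] ℝ)} (hF : ∀ s : K, ContinuousMap.evalCLM ℝ s ∈ F) {ε : ℝ}
    (hε : 0 < ε) : SliceCover F Set.univ fun y z => ‖y - z‖ ≤ 5 * ε := by
  obtain ⟨Q, hQm, hQ⟩ := exists_monotone_finset_dense Γ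
  have hd' : K ⊆ closure (Set.range fun k => (d k).1) := by
    have := Subtype.dense_iff.1 hd
    rwa [← Set.range_comp] at this
  -- The tolerance 1/(n+2) lies strictly below the 1/(n+1) of `exists_finite_control`, which turns
  -- its strict inequality into the weak one used here.
  let X : ℕ × ℕ → Set C(K, ℝ) := fun q => {x | ∃ M : Fin q.1 → Γ, ∀ s t : K,
    (∀ i, |s.1 (M i) - t.1 (M i)| ≤ 1 / ((q.2 : ℝ) + 2)) → x s - x t ≤ ε}
  have hX : (Set.univ : Set C(K, ℝ)) = ⋃ q, X q := by
    refine (Set.eq_univ_of_forall fun x => ?_).symm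
    obtain ⟨G, -, n, hn⟩ := exists_finite_control x Set.univ hε fun s t h => by
      rw [show s = t from Subtype.ext (funext fun γ => h γ trivial), sub_self, abs_zero]
    refine Set.mem_iUnion.2 ⟨(G.card, n), fun i => (G.equivFin.symm i).1, fun s t hst => ?_⟩
    refine (le_abs_self _).trans (hn s t fun γ hγ => ?_).le
    have := hst (G.equivFin ⟨γ, hγ⟩)
    simp only [Equiv.symm_apply_apply] at this
    refine this.trans_lt (one_div_lt_one_div_of_lt (by positivity) (by linarith))
  rw [hX]
  refine SliceCover.iUnion fun q => ?_
  rcases (X q).eq_empty_or_nonempty with hq | ⟨x₀, M₀, -⟩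
  · rw [hq]
    exact ⟨fun _ => ∅, Set.empty_subset _, fun _ x hx => hx.elim⟩
  have : Nonempty (Fin q.1 → Γ) := ⟨M₀⟩
  have hM : ∀ x : C(K, ℝ), ∃ M : Fin q.1 → Γ, x ∈ X q → ∀ s t : K,
      (∀ i, |s.1 (M i) - t.1 (M i)| ≤ 1 / ((q.2 : ℝ) + 2)) → x s - x t ≤ ε := by
    intro x
    by_cases hx : x ∈ X q
    · obtain ⟨M, hM⟩ := hx
      exact ⟨M, fun _ => hM⟩
    · exact ⟨M₀, fun h => absurd h hx⟩
  choose M hM using hM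
  have hδ : (0 : ℝ) < 1 / ((q.2 : ℝ) + 2) := by positivity
  obtain ⟨W, _, _, _, hW⟩ := exists_uniform_rank (isCompact_iff_compactSpace.2 ‹_›)
    (fun k => (d k).2) hdc hd' hQm hQ hdisc hδ
  -- With `q.1 + 1` rounds the cardinality alternative is impossible, since `I x` consists of
  -- indices in `Fin q.1`.
  obtain ⟨I, hcov, hI⟩ := exists_sliceCover_label hF hδ
    (fun s t hst => hW s.1 t.1 ⟨s.2, t.2, hst⟩) M hM (q.1 + 1)
  have hI' : ∀ x ∈ X q, ∀ s t : K, Agree Q s t →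
      (∀ i ∈ I x, s.1 (M x i) = t.1 (M x i)) → x s - x t ≤ ε := fun x hx =>
    (hI x hx).resolve_left (by simpa using card_finset_fin_le (I x))
  refine sliceCover_norm_of_label hQm hd M I hε hcov fun x hx s t hst h => ?_
  rw [abs_sub_le_iff]
  exact ⟨hI' x hx s t hst h, hI' x hx t s (fun n q hq => (hst n q hq).symm)
    fun i hi => (h i hi).symm⟩

/-- The functionals on `C(X, ℝ)` that are continuous for the topology of pointwise convergence. -/
def pointwiseDual (X : Type*) [TopologicalSpace X] [CompactSpace X] :
    Submodule ℝ (C(X, ℝ) →L[ℝ] ℝ) where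
  carrier := {f | ∀ y, Tendsto f (@nhds _ (pointwiseTopology X) y) (𝓝 (f y))}
  zero_mem' := fun _ => tendsto_const_nhds
  add_mem' := fun hf hg y => (hf y).add (hg y)
  smul_mem' := fun c _ hf y => (hf y).const_mul c

theorem nhds_pointwiseTopology {X : Type*} [TopologicalSpace X] (y : C(X, ℝ)) :
    @nhds _ (pointwiseTopology X) y = comap (fun f : C(X, ℝ) => (f : X → ℝ)) (𝓝 (y : X → ℝ)) :=
  nhds_induced _ y

theorem evalCLM_mem_pointwiseDual {X : Type*} [TopologicalSpace X] [CompactSpace X] (s : X) :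
    (ContinuousMap.evalCLM ℝ s : C(X, ℝ) →L[ℝ] ℝ) ∈ pointwiseDual X := by
  intro y
  rw [nhds_pointwiseTopology]
  exact ((continuous_apply s).tendsto (y : X → ℝ)).comp tendsto_comap

theorem exists_LUR_seminorm_of_continuous_dense [TopologicalSpace Γ] [PolishSpace Γ]
    [CompactSpace K] {d : ℕ → K} (hd : DenseRange d) (hdc : ∀ k, Continuous (d k).1)
    (hdisc : ∀ s ∈ K, {γ : Γ | ¬ ContinuousAt s γ}.Countable) :
    ∃ ν : Seminorm ℝ C(K, ℝ), IsEquivalentNorm ν ∧ IsPointwiseLSC ν ∧ IsLUR ν := by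
  obtain ⟨ν, h1, h2, h3⟩ := exists_LUR_seminorm_of_sliceCover
    (fun y : C(K, ℝ) => @nhds _ (pointwiseTopology K) y) (fun c y => by
      rw [nhds_pointwiseTopology, nhds_pointwiseTopology, tendsto_comap_iff]
      exact ((continuous_const_smul c).tendsto (y : K → ℝ)).comp tendsto_comap)
    (pointwiseDual K) (fun f hf y => hf y) (fun x c hc h => by
      have hnorm : ∀ s : K, ‖(ContinuousMap.evalCLM ℝ s : C(K, ℝ) →L[ℝ] ℝ)‖ ≤ 1 := fun s =>
        ContinuousLinearMap.opNorm_le_bound _ zero_le_one fun y => by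
          rw [one_mul]
          exact y.norm_coe_le_norm s
      refine (ContinuousMap.norm_le _ hc).2 fun s => abs_le.2 ⟨?_, ?_⟩
      · have := h (-ContinuousMap.evalCLM ℝ s)
          ((pointwiseDual K).neg_mem (evalCLM_mem_pointwiseDual s)) (by
            rw [norm_neg]
            exact hnorm s)
        rw [neg_apply, ContinuousMap.evalCLM_apply] at this
        linarith
      · exact h _ (evalCLM_mem_pointwiseDual s) (hnorm s))
    (fun ε hε => by
      have := sliceCover_norm hd hdc hdisc evalCLM_mem_pointwiseDual
        (show 0 < ε / 5 by positivity)
      rwa [mul_div_cancel₀ ε (by norm_num : (5 : ℝ) ≠ 0)] at this)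
  exact ⟨ν, h1, fun y c hc => h2 y c hc, h3⟩

end Main

theorem theorem1 {Γ : Type*} [TopologicalSpace Γ] [PolishSpace Γ]
    (K : Set (Γ → ℝ)) [CompactSpace K] [TopologicalSpace.SeparableSpace K]
    (hdisc : ∀ s ∈ K, {γ : Γ | ¬ ContinuousAt s γ}.Countable) :
    ∃ ν : Seminorm ℝ C(K, ℝ), IsEquivalentNorm ν ∧ IsPointwiseLSC ν ∧ IsLUR ν := by
  -- `TopologicalSpace.denseSeq` needs `K` nonempty; for empty `K` the space C(K) is trivial.
  rcases isEmpty_or_nonempty K with hK | hK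
  · have hzero : ∀ x : C(K, ℝ), normSeminorm ℝ C(K, ℝ) x = 0 := fun x => by
      rw [Subsingleton.elim x 0, map_zero]
    refine ⟨normSeminorm ℝ C(K, ℝ), ⟨1, 1, one_pos, one_pos, fun x => ?_⟩, fun x c hc => ?_,
      fun x₀ x _ _ => ?_⟩
    · simp
    · refine Eventually.of_forall fun z => ?_
      rw [Subsingleton.elim z x]
      exact hc
    · simp only [hzero]
      exact tendsto_const_nhds
  obtain ⟨t', -, hP, hcont, hsub⟩ := exists_polishSpace_continuous
    (fun k => (TopologicalSpace.denseSeq K k).1) fun k => hdisc _ (TopologicalSpace.denseSeq K k).2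
  exact exists_LUR_seminorm_of_continuous_dense (TopologicalSpace.denseRange_denseSeq K) hcont
    fun s hs => (hdisc s hs).mono (hsub s)
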